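/- **Setting.** $n\ge 1$ nodes minimise $f(x)=\frac1n\sum_{i=1}^n f_i(x)$ over $x\in\mathbb R^d$, where $f_i(x)=\mathbb E_{\xi\sim\mathcal D_i}F_i(x;\xi)$ and the stochastic gradients are unbiased, $\mathbb E_{\xi\sim\mathcal D_i}\nabla F_i(x;\xi)=\nabla f_i(x)$. Assume that $f$ is bounded below and put $F_0=f(x^{0})-\inf f$; that each $f_i$ is $L$-smooth, i.e. differentiable with $\|\nabla f_i(x)-\nabla f_i(y)\|\le L\|x-y\|$ ($L>0$); that $\mathbb E_{\xi\sim\mathcal D_i}\|\nabla F_i(x;\xi)-\nabla f_i(x)\|^2\le\sigma^2$ for all $i,x$; and that $W=(w_{ij})\in\mathbb R^{n\times n}$ is symmetric, doubly stochastic and nonnegative with $\|XW-\bar X\|_F^2\le(1-p)\|X-\bar X\|_F^2$ for all $X\in\mathbb R^{d\times n}$, where $0<p\le1$ and every column of $\bar X$ is the average of the columns of $X$. Let $K\ge1$ be the number of local steps, $\eta_s,\eta_c>0$ constant stepsizes, $\eta=\eta_s\eta_c$, and let $\xi_i^{(t)+k}\sim\mathcal D_i$ ($t\ge 0$, $0\le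 k<K$, $1\le i\le n$) be mutually independent samples. We write $x_i^{(t)}=x_i^{(t)+0}$, and likewise for $z$ and $\xi$. *Periodical GT.* Start with $x_i^{(0)}=x^0$ and $z_i^{(0)}=\frac1n\sum_j\nabla F_j(x^0;\xi_j^{(0)})$. In round $t$, for $k=0,\dots,K-2$, $$x_i^{(t)+k+1}=x_i^{(t)+k}-\eta_c z_i^{(t)+k},\qquad z_i^{(t)+k+1}=z_i^{(t)+k}+\nabla F_i(x_i^{(t)+k+1};\xi_i^{(t)+k+1})-\nabla F_i(x_i^{(t)+k};\xi_i^{(t)+k}),$$ then $x_i^{(t)+K}=x_i^{(t)+K-1}-\eta_cz_i^{(t)+K-1}$ and, with communication, $$x_i^{(t+1)}=\sum_jw_{ij}\big(x_j^{(t)}-\eta_s(x_j^{(t)}-x_j^{(t)+K})\big),\qquad z_i^{(t+1)}=\sum_jw_{ij}z_j^{(t)+K-1}+\nabla F_i(x_i^{(t+1)};\xi_i^{(t+1)})-\nabla F_i(x_i^{(t)+K-1};\xi_i^{(t)+K-1}).$$ *Full-batch-tracking variant.* Start with $x_i^{(0)}=x^0$ and $c_i^{(0)}=-a_i+\frac1n\sum_ja_j$.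 In round $t$, $x_i^{(t)+k+1}=x_i^{(t)+k}-\eta_c(\nabla F_i(x_i^{(t)+k};\xi_i^{(t)+k})+c_i^{(t)})$ for $k=0,\dots,K-2$; then, with $g_i=\nabla f_i(x_i^{(t)+K-1})$, $x_i^{(t)+K}=x_i^{(t)+K-1}-\eta_c(g_i+c_i^{(t)})$, the model update $x_i^{(t+1)}$ is as above, and $c_i^{(t+1)}=\sum_jw_{ij}c_j^{(t)}+\sum_jw_{ij}g_j-g_i$. **Theorem.** There is a universal constant $C>0$ such that for all $n,K,L,\sigma\ge 0,p$ and $\varepsilon>0$ as above there are, for each of the two algorithms, constant stepsizes, depending only on these parameters, with $\eta\le C\,p^2/(KL)$, such that under the assumptions above $$\frac1{T+1}\sum_{t=0}^{T}\mathbb E\|\nabla f(\bar x^{(t)})\|^2\le\varepsilon ,\qquad \bar x^{(t)}=\frac1n\sum_ix_i^{(t)},$$ (with finite expectations) for every number of communication rounds $T\ge R$, where 1. for Periodical GT, $R=C\Big(\dfrac{\sigma^2}{Kn\varepsilon^2}+\dfrac{\sigma}{p^2\varepsilon^{3/2}}+\dfrac1{p^2\varepsilon}\Big)LF_0$; 2.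 for the full-batch-tracking variant with corrections initialised by full gradients, $a_i=\nabla f_i(x^0)$, $R=C\Big(\dfrac{\sigma^2}{Kn\varepsilon^2}+\dfrac{\sigma}{p^2\sqrt K\,\varepsilon^{3/2}}+\dfrac1{p^2\varepsilon}\Big)LF_0$; with the same stepsizes, but corrections initialised by single stochastic gradients $a_i=\nabla F_i(x^0;\xi_i^{(0)})$, the same holds with $R$ increased by $C\sigma^2/\varepsilon$. -/

import Mathlib

open MeasureTheory ProbabilityTheory

noncomputable section

/-- The space `ℝ^d` with its Euclidean norm. -/
abbrev Vec (d : ℕ) := EuclideanSpace ℝ (Fin d)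

/-- The average `(1/n) ∑ᵢ Xᵢ` of one vector per node. -/
def nodeMean {d n : ℕ} (X : Fin n → Vec d) : Vec d :=
  (1 / (n : ℝ)) • ∑ i, X i

/-- One averaging step over the network: node `i` receives `∑ⱼ wᵢⱼ Xⱼ`. -/
def mix {d n : ℕ} (W : Matrix (Fin n) (Fin n) ℝ) (X : Fin n → Vec d) : Fin n → Vec d :=
  fun i => ∑ j, W i j • X j

/-- The local objective `fᵢ(x) = 𝔼_{ξ ∼ Dᵢ} Fᵢ(x; ξ)`. -/
def localObj {d n : ℕ} {Ξ : Type*} [MeasurableSpace Ξ] (F : Fin n → Vec d → Ξ → ℝ)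
    (D : Fin n → Measure Ξ) (i : Fin n) (x : Vec d) : ℝ :=
  ∫ ξ, F i x ξ ∂(D i)

/-- The global objective `f(x) = (1/n) ∑ᵢ fᵢ(x)`. -/
def globalObj {d n : ℕ} {Ξ : Type*} [MeasurableSpace Ξ] (F : Fin n → Vec d → Ξ → ℝ)
    (D : Fin n → Measure Ξ) (x : Vec d) : ℝ :=
  (1 / (n : ℝ)) * ∑ i, localObj F D i x

/-- The stochastic gradient `∇Fᵢ(x; ξ)` (gradient in `x`). -/
def stochGrad {d n : ℕ} {Ξ : Type*} (F : Fin n → Vec d → Ξ → ℝ)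
    (i : Fin n) (x : Vec d) (ξ : Ξ) : Vec d :=
  gradient (fun y => F i y ξ) x

/-- The full local gradient `∇fᵢ(x)`. -/
def fullGrad {d n : ℕ} {Ξ : Type*} [MeasurableSpace Ξ] (F : Fin n → Vec d → Ξ → ℝ)
    (D : Fin n → Measure Ξ) (i : Fin n) (x : Vec d) : Vec d :=
  gradient (localObj F D i) x

/-- The stochastic objectives are well posed: `fᵢ` is an honest expectation, `Fᵢ(·; ξ)` has a
gradient, which is measurable, and the stochastic gradient is unbiased:
`𝔼_{ξ ∼ Dᵢ} ∇Fᵢ(x; ξ) = ∇fᵢ(x)`. -/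
structure IsStochasticObjective {d n : ℕ} {Ξ : Type*} [MeasurableSpace Ξ]
    (F : Fin n → Vec d → Ξ → ℝ) (D : Fin n → Measure Ξ) : Prop where
  isProb : ∀ i, IsProbabilityMeasure (D i)
  integrable : ∀ i x, Integrable (F i x) (D i)
  differentiableAt : ∀ i x, ∀ᵐ ξ ∂(D i), DifferentiableAt ℝ (fun y => F i y ξ) x
  measurable_grad : ∀ i, Measurable (fun q : Vec d × Ξ => stochGrad F i q.1 q.2)
  unbiased : ∀ i x, ∫ ξ, stochGrad F i x ξ ∂(D i) = fullGrad F D i x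

/-- Every `fᵢ` is `L`-smooth: differentiable with an `L`-Lipschitz gradient. -/
def IsSmooth {d n : ℕ} {Ξ : Type*} [MeasurableSpace Ξ] (F : Fin n → Vec d → Ξ → ℝ)
    (D : Fin n → Measure Ξ) (L : ℝ) : Prop :=
  ∀ i, Differentiable ℝ (localObj F D i) ∧
    ∀ x y, ‖fullGrad F D i x - fullGrad F D i y‖ ≤ L * ‖x - y‖

/-- Bounded variance: `𝔼_{ξ ∼ Dᵢ} ‖∇Fᵢ(x; ξ) - ∇fᵢ(x)‖² ≤ σ²` for all `i` and `x`. -/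
def HasBoundedVariance {d n : ℕ} {Ξ : Type*} [MeasurableSpace Ξ] (F : Fin n → Vec d → Ξ → ℝ)
    (D : Fin n → Measure Ξ) (σ : ℝ) : Prop :=
  ∀ i x, Integrable (fun ξ => ‖stochGrad F i x ξ - fullGrad F D i x‖ ^ 2) (D i) ∧
    ∫ ξ, ‖stochGrad F i x ξ - fullGrad F D i x‖ ^ 2 ∂(D i) ≤ σ ^ 2

/-- `W` is a symmetric, doubly stochastic, nonnegative mixing matrix, and one averaging step
contracts the squared (Frobenius) distance to consensus in `ℝ^{d × n}` by the factor `1 - p`. -/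
structure IsMixing (d : ℕ) {n : ℕ} (W : Matrix (Fin n) (Fin n) ℝ) (p : ℝ) : Prop where
  symm : W.IsSymm
  nonneg : ∀ i j, 0 ≤ W i j
  row_sum : ∀ i, ∑ j, W i j = 1
  col_sum : ∀ j, ∑ i, W i j = 1
  contract : ∀ X : Fin n → Vec d,
    ∑ i, ‖mix W X i - nodeMean X‖ ^ 2 ≤ (1 - p) * ∑ i, ‖X i - nodeMean X‖ ^ 2

/-- `ξ t k i` is the sample drawn by node `i` at local step `k < K` of round `t`: it has law `Dᵢ`,
and all these samples are mutually independent. -/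
structure IsSampling {n : ℕ} {Ξ Ω : Type*} [MeasurableSpace Ξ] [MeasurableSpace Ω]
    (P : Measure Ω) (D : Fin n → Measure Ξ) (K : ℕ) (ξ : ℕ → ℕ → Fin n → Ω → Ξ) : Prop where
  measurable : ∀ t, ∀ k < K, ∀ i, Measurable (ξ t k i)
  law : ∀ t, ∀ k < K, ∀ i, P.map (ξ t k i) = D i
  indep : iIndepFun (fun (q : ℕ × Fin K × Fin n) => ξ q.1 q.2.1 q.2.2) P

/-! ### Periodical gradient tracking

`G i x s` is the stochastic gradient of node `i` at `x` with sample `s`. A pair `(X, Z)` holds the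
models and the tracking variables of all nodes. -/

/-- The pair `(x^{(t)+k}, z^{(t)+k})` after `k` local steps of a round that starts in `S`, where
`s k i` is the sample of node `i` at local step `k` of that round. -/
def pgtLocal {d n : ℕ} {Ξ : Type*} (G : Fin n → Vec d → Ξ → Vec d) (ηc : ℝ)
    (s : ℕ → Fin n → Ξ) (S : (Fin n → Vec d) × (Fin n → Vec d)) :
    ℕ → (Fin n → Vec d) × (Fin n → Vec d)
  | 0 => S
  | k + 1 =>
    let Y := (pgtLocal G ηc s S k).1
    let U := (pgtLocal G ηc s S k).2
    let Y' : Fin n → Vec d := fun i => Y i - ηc • U i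
    (Y', fun i => U i + G i (Y' i) (s (k + 1) i) - G i (Y i) (s k i))

/-- One round: `K - 1` local steps, then a last model step and the communication; `s` are the
samples of this round, `s'` those of the next one. -/
def pgtRound {d n : ℕ} {Ξ : Type*} (G : Fin n → Vec d → Ξ → Vec d)
    (W : Matrix (Fin n) (Fin n) ℝ) (K : ℕ) (ηs ηc : ℝ) (s s' : ℕ → Fin n → Ξ)
    (S : (Fin n → Vec d) × (Fin n → Vec d)) : (Fin n → Vec d) × (Fin n → Vec d) :=
  let X := S.1
  let Y := (pgtLocal G ηc s S (K - 1)).1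
  let U := (pgtLocal G ηc s S (K - 1)).2
  let XK : Fin n → Vec d := fun i => Y i - ηc • U i
  let X' : Fin n → Vec d := mix W (fun j => X j - ηs • (X j - XK j))
  (X', fun i => mix W U i + G i (X' i) (s' 0 i) - G i (Y i) (s (K - 1) i))

/-- Periodical GT: models and tracking variables at the beginning of round `t`, from the common
model `x0` and the averaged stochastic gradient at `x0` as tracking variable, along the sample
path `s t k i`. -/
def pgt {d n : ℕ} {Ξ : Type*} (G : Fin n → Vec d → Ξ → Vec d)
    (W : Matrix (Fin n) (Fin n) ℝ) (K : ℕ) (ηs ηc : ℝ) (x0 : Vec d)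
    (s : ℕ → ℕ → Fin n → Ξ) : ℕ → (Fin n → Vec d) × (Fin n → Vec d)
  | 0 => (fun _ => x0, fun _ => nodeMean fun j => G j x0 (s 0 0 j))
  | t + 1 => pgtRound G W K ηs ηc (s t) (s (t + 1)) (pgt G W K ηs ηc x0 s t)

/-! ### Periodical gradient tracking with full-batch tracking

`g i x` is the full gradient `∇fᵢ(x)`. A pair `(X, C)` holds models and corrections. -/

/-- The models after `k` local steps with stochastic gradients and fixed corrections `C`. -/
def fpgtLocal {d n : ℕ} {Ξ : Type*} (G : Fin n → Vec d → Ξ → Vec d) (ηc : ℝ)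
    (s : ℕ → Fin n → Ξ) (X C : Fin n → Vec d) : ℕ → Fin n → Vec d
  | 0 => X
  | k + 1 => fun i =>
    let Y := fpgtLocal G ηc s X C k
    Y i - ηc • (G i (Y i) (s k i) + C i)

/-- One round: `K - 1` local steps with stochastic gradients, a last local step with the full
gradient, then the communication, where the full gradient updates the corrections. -/
def fpgtRound {d n : ℕ} {Ξ : Type*} (G : Fin n → Vec d → Ξ → Vec d)
    (g : Fin n → Vec d → Vec d) (W : Matrix (Fin n) (Fin n) ℝ) (K : ℕ) (ηs ηc : ℝ)
    (s : ℕ → Fin n → Ξ) (S : (Fin n → Vec d) × (Fin n → Vec d)) :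
    (Fin n → Vec d) × (Fin n → Vec d) :=
  let X := S.1
  let C := S.2
  let Y := fpgtLocal G ηc s X C (K - 1)
  let h : Fin n → Vec d := fun i => g i (Y i)
  let XK : Fin n → Vec d := fun i => Y i - ηc • (h i + C i)
  (mix W (fun j => X j - ηs • (X j - XK j)), fun i => mix W C i + mix W h i - h i)

/-- Full-batch-tracking Periodical GT: models and corrections at the beginning of round `t`, from
the common model `x0` and the corrections `c⁰ᵢ = -aᵢ + (1/n) ∑ⱼ aⱼ`, where `aᵢ` is the gradient
that node `i` uses at initialization. -/
def fpgt {d n : ℕ} {Ξ : Type*} (G : Fin n → Vec d → Ξ → Vec d)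
    (g : Fin n → Vec d → Vec d) (W : Matrix (Fin n) (Fin n) ℝ) (K : ℕ) (ηs ηc : ℝ)
    (x0 : Vec d) (a : Fin n → Vec d) (s : ℕ → ℕ → Fin n → Ξ) :
    ℕ → (Fin n → Vec d) × (Fin n → Vec d)
  | 0 => (fun _ => x0, fun i => -a i + nodeMean a)
  | t + 1 => fpgtRound G g W K ηs ηc (s t) (fpgt G g W K ηs ηc x0 a s t)

/-- After `R` communication rounds the averaged expected squared gradient norm at the node averages
`x̄^{(t)}` is at most `ε`: `(1/(T+1)) ∑_{t ≤ T} 𝔼‖∇f(x̄^{(t)})‖² ≤ ε` for every `T ≥ R`, all the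
expectations being finite. -/
def StationaryAfter {d n : ℕ} {Ω : Type*} [MeasurableSpace Ω] (P : Measure Ω) (f : Vec d → ℝ)
    (X : ℕ → Ω → Fin n → Vec d) (ε R : ℝ) : Prop :=
  (∀ t, Integrable (fun ω => ‖gradient f (nodeMean (X t ω))‖ ^ 2) P) ∧
  ∀ T : ℕ, R ≤ (T : ℝ) →
    (1 / ((T : ℝ) + 1)) *
      ∑ t ∈ Finset.range (T + 1), ∫ ω, ‖gradient f (nodeMean (X t ω))‖ ^ 2 ∂P ≤ ε

end

/-! Both algorithms are one gradient tracking scheme. Take η_s = 1. Subtracting from the tracking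
variable `z` the current stochastic gradient leaves a correction `c` that is constant during a
round, has node mean zero, and is updated by c ← Wc + Wh − h, where h are the gradients of the last
local step (`pgt_eq`, `fpgt_eq`). The algorithms differ in the variance τ² of h, which is at most σ²
for Periodical GT and 0 for full-batch tracking. The analysis needs of the randomness only that the
noise of a round is uncorrelated across steps and nodes, and uncorrelated with the mean gradient at
the start of the round (`IsTrackingRun`, verified in `isTrackingRun_track`).

Expand a round at the node average v: each local direction is gradient deviation + noise + tracking
error + ∇f(v) (`IsLocalPath.eq_sub`). The tracking error has mean zero, so it does not move the
average; ∇f(v) is common to all nodes, so it does not affect consensus. Write u = KLη, G =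
𝔼‖∇f(v)‖², φ = 𝔼f(v)/(ηK), δ for L² times the consensus error and Γ for the tracking error. Up to
constants and smaller terms, φ' ≤ φ − (3/8)G + 2δ + uσ²/(Kn) (`descent`), δ' ≤ (1 − p/2)δ + (u²/p)(Γ
+ σ²/K) (`consensusErr_succ_le`), Γ' ≤ (1 − p/2)Γ + (1/p)(δ + τ² + u²(G + σ²/K))
(`correctionErr_succ_le`).

The loop δ → Γ → δ has gain of order u²/p², to be beaten by the contractions (p/2)². This is why u =
qp² with a small q. Then φ + (8/p)δ + 200q²pΓ decreases by G/4 per round, up to noise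
(`lyapunov_step`), and telescoping bounds the average of G by a multiple of (LF₀/(qp²) +
q²pΓ₀)/(T+1) + qp²σ²/(Kn) + q²(σ²/K + τ²) (`average_gradSq_le`).

Finally `relStep` makes every noise term a small multiple of ε. Its reciprocal is a sum of three
terms, and they become the three terms of the round count (`div_relStep`). The standard deviation to
be compensated is σ for Periodical GT and σ/√K for full-batch tracking. -/

noncomputable section

/-! ### Averages over the nodes -/

/-- The mean square `(1/n) ∑ᵢ ‖Yᵢ‖²` of one vector per node. -/
def avgSq {d n : ℕ} (Y : Fin n → Vec d) : ℝ :=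
  (1 / (n : ℝ)) * ∑ i, ‖Y i‖ ^ 2

section Averages

variable {d n : ℕ}

theorem avgSq_nonneg (Y : Fin n → Vec d) : 0 ≤ avgSq Y := by
  unfold avgSq; positivity

theorem avgSq_le_of_le {X Y : Fin n → Vec d} {a : ℝ} (h : ∀ i, ‖X i‖ ^ 2 ≤ a * ‖Y i‖ ^ 2) :
    avgSq X ≤ a * avgSq Y := by
  unfold avgSq
  rw [mul_left_comm, Finset.mul_sum _ _ a]
  exact mul_le_mul_of_nonneg_left (Finset.sum_le_sum fun i _ => h i) (by positivity)

theorem avgSq_smul (a : ℝ) (Y : Fin n → Vec d) : avgSq (a • Y) = a ^ 2 * avgSq Y := by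
  simp only [avgSq, Pi.smul_apply, norm_smul, mul_pow, Real.norm_eq_abs, sq_abs,
    ← Finset.mul_sum]
  ring

theorem avgSq_neg (Y : Fin n → Vec d) : avgSq (-Y) = avgSq Y := by
  simp [avgSq]

theorem avgSq_const (hn : 1 ≤ n) (v : Vec d) : avgSq (fun _ : Fin n => v) = ‖v‖ ^ 2 := by
  have : (n : ℝ) ≠ 0 := by positivity
  simp [avgSq, this]

theorem norm_add_sq_le_young {E : Type*} [NormedAddCommGroup E] [InnerProductSpace ℝ E]
    {θ : ℝ} (hθ : 0 < θ) (a b : E) :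
    ‖a + b‖ ^ 2 ≤ (1 + θ) * ‖a‖ ^ 2 + (1 + 1 / θ) * ‖b‖ ^ 2 := by
  have h1 : ‖a + b‖ ^ 2 ≤ (‖a‖ + ‖b‖) ^ 2 := by
    gcongr; exact norm_add_le a b
  have h2 : 0 ≤ (θ * ‖a‖ - ‖b‖) ^ 2 / θ := by positivity
  have h3 : (θ * ‖a‖ - ‖b‖) ^ 2 / θ = θ * ‖a‖ ^ 2 - 2 * ‖a‖ * ‖b‖ + 1 / θ * ‖b‖ ^ 2 := by
    -- The square is divided by θ so that its cross term is exactly that of (‖a‖ + ‖b‖)².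
    field_simp; ring
  nlinarith

theorem avgSq_add_le_young {θ : ℝ} (hθ : 0 < θ) (A B : Fin n → Vec d) :
    avgSq (A + B) ≤ (1 + θ) * avgSq A + (1 + 1 / θ) * avgSq B := by
  have h : ∑ i, ‖(A + B) i‖ ^ 2 ≤ (1 + θ) * ∑ i, ‖A i‖ ^ 2 + (1 + 1 / θ) * ∑ i, ‖B i‖ ^ 2 := by
    rw [Finset.mul_sum, Finset.mul_sum, ← Finset.sum_add_distrib]
    exact Finset.sum_le_sum fun i _ => norm_add_sq_le_young hθ (A i) (B i)
  have := mul_le_mul_of_nonneg_left h (show 0 ≤ 1 / (n : ℝ) by positivity)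
  unfold avgSq
  linarith

theorem avgSq_add_le (A B : Fin n → Vec d) : avgSq (A + B) ≤ 2 * avgSq A + 2 * avgSq B := by
  have := avgSq_add_le_young one_pos A B
  norm_num at this ⊢; exact this

theorem avgSq_sub_le (A B : Fin n → Vec d) : avgSq (A - B) ≤ 2 * avgSq A + 2 * avgSq B := by
  rw [sub_eq_add_neg, ← avgSq_neg B]; exact avgSq_add_le A (-B)

theorem avgSq_add_three_le (A B C : Fin n → Vec d) :
    avgSq (A + B + C) ≤ 3 * (avgSq A + avgSq B + avgSq C) := by
  have h1 := avgSq_add_le_young (θ := 1 / 2) (by norm_num) (A + B) C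
  have h2 := avgSq_add_le A B
  norm_num at h1
  linarith

theorem avgSq_add_four_le (A B C D : Fin n → Vec d) :
    avgSq (A + B + C + D) ≤ 4 * (avgSq A + avgSq B + avgSq C + avgSq D) := by
  have h1 := avgSq_add_le (A + B) (C + D)
  have h2 := avgSq_add_le A B
  have h3 := avgSq_add_le C D
  rw [← add_assoc] at h1
  linarith

theorem avgSq_sum_le {ι : Type*} (s : Finset ι) (A : ι → Fin n → Vec d) :
    avgSq (∑ l ∈ s, A l) ≤ s.card * ∑ l ∈ s, avgSq (A l) := by
  have h : ∀ i, ‖(∑ l ∈ s, A l) i‖ ^ 2 ≤ s.card * ∑ l ∈ s, ‖A l i‖ ^ 2 := fun i => by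
    rw [Finset.sum_apply]
    calc ‖∑ l ∈ s, A l i‖ ^ 2 ≤ (∑ l ∈ s, ‖A l i‖) ^ 2 := by
          gcongr; exact norm_sum_le _ _
      _ ≤ _ := sq_sum_le_card_mul_sum_sq
  unfold avgSq
  rw [← Finset.mul_sum, Finset.sum_comm, mul_left_comm, Finset.mul_sum _ _ (s.card : ℝ)]
  exact mul_le_mul_of_nonneg_left (Finset.sum_le_sum fun i _ => h i) (by positivity)

theorem nodeMean_add (A B : Fin n → Vec d) : nodeMean (A + B) = nodeMean A + nodeMean B := by
  simp [nodeMean, Finset.sum_add_distrib]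

theorem nodeMean_sub (A B : Fin n → Vec d) : nodeMean (A - B) = nodeMean A - nodeMean B := by
  simp [nodeMean, Finset.sum_sub_distrib, smul_sub]

theorem nodeMean_smul (a : ℝ) (A : Fin n → Vec d) : nodeMean (a • A) = a • nodeMean A := by
  simp only [nodeMean, Pi.smul_apply, ← Finset.smul_sum]
  rw [smul_comm]

theorem nodeMean_const (hn : 1 ≤ n) (v : Vec d) : nodeMean (fun _ : Fin n => v) = v := by
  have : (n : ℝ) ≠ 0 := by positivity
  simp [nodeMean, ← Nat.cast_smul_eq_nsmul ℝ, smul_smul, this]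

theorem avgSq_sub_const (hn : 1 ≤ n) (Y : Fin n → Vec d) (w : Vec d) :
    avgSq (Y - fun _ => w) = avgSq Y - 2 * inner ℝ (nodeMean Y) w + ‖w‖ ^ 2 := by
  have : (n : ℝ) ≠ 0 := by positivity
  simp only [avgSq, nodeMean, Pi.sub_apply, norm_sub_sq_real, Finset.sum_add_distrib,
    Finset.sum_sub_distrib, inner_smul_left, sum_inner, ← Finset.mul_sum]
  simp
  field_simp

theorem avgSq_sub_mean (hn : 1 ≤ n) (Y : Fin n → Vec d) :
    avgSq (Y - fun _ => nodeMean Y) = avgSq Y - ‖nodeMean Y‖ ^ 2 := by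
  rw [avgSq_sub_const hn, real_inner_self_eq_norm_sq]; ring

theorem avgSq_sub_mean_le (hn : 1 ≤ n) (Y : Fin n → Vec d) :
    avgSq (Y - fun _ => nodeMean Y) ≤ avgSq Y := by
  rw [avgSq_sub_mean hn]; nlinarith [sq_nonneg ‖nodeMean Y‖]

theorem norm_nodeMean_sq_le (hn : 1 ≤ n) (Y : Fin n → Vec d) : ‖nodeMean Y‖ ^ 2 ≤ avgSq Y := by
  have := avgSq_sub_mean hn Y
  have := avgSq_nonneg (Y - fun _ => nodeMean Y)
  linarith

theorem mix_add (W : Matrix (Fin n) (Fin n) ℝ) (A B : Fin n → Vec d) :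
    mix W (A + B) = mix W A + mix W B := by
  ext1 i; simp [mix, Finset.sum_add_distrib]

theorem nodeMean_mix {W : Matrix (Fin n) (Fin n) ℝ} {p : ℝ} (hW : IsMixing d W p)
    (Y : Fin n → Vec d) : nodeMean (mix W Y) = nodeMean Y := by
  unfold nodeMean mix
  rw [Finset.sum_comm]
  simp [← Finset.sum_smul, hW.col_sum]

theorem avgSq_mix_sub_mean_le {W : Matrix (Fin n) (Fin n) ℝ} {p : ℝ} (hW : IsMixing d W p)
    (Y : Fin n → Vec d) :
    avgSq (mix W Y - fun _ => nodeMean Y) ≤ (1 - p) * avgSq (Y - fun _ => nodeMean Y) := by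
  have := mul_le_mul_of_nonneg_left (hW.contract Y) (show 0 ≤ 1 / (n : ℝ) by positivity)
  unfold avgSq
  simp only [Pi.sub_apply]
  linarith

/-- Mixing preserves the mean and contracts the deviation from it, and these two parts are
orthogonal. -/
theorem avgSq_mix_le (hn : 1 ≤ n) {W : Matrix (Fin n) (Fin n) ℝ} {p : ℝ} (hp : 0 < p)
    (hW : IsMixing d W p) (Y : Fin n → Vec d) : avgSq (mix W Y) ≤ avgSq Y := by
  have h1 := avgSq_mix_sub_mean_le hW Y
  have h2 := avgSq_sub_mean hn (mix W Y)
  rw [nodeMean_mix hW] at h2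
  have h3 := avgSq_sub_mean hn Y
  nlinarith [avgSq_nonneg (Y - fun _ => nodeMean Y)]

end Averages

/-! ### One round of local steps with perturbed gradients -/

section Round

variable {d n : ℕ}

/-- The deviation `cᵢ + gᵢ(v) - (1/n) ∑ⱼ gⱼ(v)` of the corrections from their ideal value at `v`. -/
def trackErr (g : Fin n → Vec d → Vec d) (c : Fin n → Vec d) (v : Vec d) : Fin n → Vec d :=
  fun i => c i + g i v - nodeMean fun j => g j v

/-- The change of the local gradients from the common point `v` to the points `Yᵢ`. -/
def gradDev (g : Fin n → Vec d → Vec d) (Y : Fin n → Vec d) (v : Vec d) : Fin n → Vec d :=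
  fun i => g i (Y i) - g i v

theorem avgSq_gradDev_le {g : Fin n → Vec d → Vec d} {L : ℝ}
    (hg : ∀ i x y, ‖g i x - g i y‖ ≤ L * ‖x - y‖) (Y : Fin n → Vec d) (v : Vec d) :
    avgSq (gradDev g Y v) ≤ L ^ 2 * avgSq (Y - fun _ => v) := by
  refine avgSq_le_of_le fun i => ?_
  rw [← mul_pow]
  exact pow_le_pow_left₀ (norm_nonneg _) (hg i _ _) 2

theorem avgSq_gradDev_le_drift {g : Fin n → Vec d → Vec d} {L : ℝ}
    (hg : ∀ i x y, ‖g i x - g i y‖ ≤ L * ‖x - y‖) (X Y : Fin n → Vec d) (v : Vec d) :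
    avgSq (gradDev g Y v) ≤ 2 * L ^ 2 * (avgSq (Y - X) + avgSq (X - fun _ => v)) := by
  have h1 := avgSq_gradDev_le hg Y v
  have h2 := avgSq_add_le (Y - X) (X - fun _ => v)
  rw [sub_add_sub_cancel] at h2
  nlinarith [sq_nonneg L]

theorem nodeMean_trackErr (hn : 1 ≤ n) (g : Fin n → Vec d → Vec d) {c : Fin n → Vec d}
    (hc : nodeMean c = 0) (v : Vec d) : nodeMean (trackErr g c v) = 0 := by
  have : trackErr g c v = c + (fun i => g i v) - fun _ => nodeMean fun j => g j v := rfl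
  rw [this, nodeMean_sub, nodeMean_add, nodeMean_const hn, hc]; simp

/-- The local models `y`, started in `x` and corrected by `c`, follow perturbed gradient steps:
`N k` is the perturbation at step `k`. -/
structure IsLocalPath (g : Fin n → Vec d → Vec d) (η : ℝ) (K : ℕ) (x c : Fin n → Vec d)
    (y N : ℕ → Fin n → Vec d) : Prop where
  zero : y 0 = x
  succ : ∀ k < K, ∀ i, y (k + 1) i = y k i - η • (g i (y k i) + N k i + c i)

variable {g : Fin n → Vec d → Vec d} {η : ℝ} {K : ℕ} {x c : Fin n → Vec d}
  {y N : ℕ → Fin n → Vec d}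

/-- The decomposition behind all one-round estimates. Adding and subtracting the gradients at `v`
splits gᵢ(yᵢ) + cᵢ into a smoothness error, a tracking error and a direction shared by all nodes. -/
theorem IsLocalPath.eq_sub (h : IsLocalPath g η K x c y N) {k : ℕ} (hk : k ≤ K) (v : Vec d) :
    y k = x - η • (∑ l ∈ Finset.range k, gradDev g (y l) v + (k : ℝ) • trackErr g c v
      + ∑ l ∈ Finset.range k, N l + (k : ℝ) • fun _ => nodeMean fun j => g j v) := by
  induction k with
  | zero => simp [h.zero]
  | succ k ih =>
    ext1 i
    rw [h.succ k (by omega) i]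
    conv_lhs => enter [1]; rw [ih (by omega)]
    simp only [Finset.sum_range_succ, Pi.sub_apply, Pi.add_apply, Pi.smul_apply, trackErr, gradDev]
    push_cast
    module

theorem IsLocalPath.drift_le (hn : 1 ≤ n) (h : IsLocalPath g η K x c y N) {k : ℕ} (hk : k ≤ K)
    (v : Vec d) :
    avgSq (y k - x) ≤ 4 * η ^ 2 * (k * ∑ l ∈ Finset.range k, avgSq (gradDev g (y l) v)
      + k ^ 2 * avgSq (trackErr g c v) + avgSq (∑ l ∈ Finset.range k, N l)
      + k ^ 2 * ‖nodeMean fun j => g j v‖ ^ 2) := by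
  have e : y k - x = (-η) • (∑ l ∈ Finset.range k, gradDev g (y l) v + (k : ℝ) • trackErr g c v
      + ∑ l ∈ Finset.range k, N l + (k : ℝ) • fun _ => nodeMean fun j => g j v) := by
    rw [h.eq_sub hk v, neg_smul]; abel
  rw [e, avgSq_smul, neg_sq]
  have h4 := avgSq_add_four_le (∑ l ∈ Finset.range k, gradDev g (y l) v)
    ((k : ℝ) • trackErr g c v) (∑ l ∈ Finset.range k, N l)
    ((k : ℝ) • fun _ => nodeMean fun j => g j v)
  have h5 := avgSq_sum_le (Finset.range k) fun l => gradDev g (y l) v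
  rw [avgSq_smul, avgSq_smul, avgSq_const hn] at h4
  rw [Finset.card_range] at h5
  nlinarith [sq_nonneg η]

/-- The common direction `q` cancels in the deviation from the mean, so no gradient norm appears.
Young's inequality with θ = p/2 spends half of the contraction of W on the other terms. -/
theorem IsLocalPath.consensus_le (hn : 1 ≤ n) {W : Matrix (Fin n) (Fin n) ℝ} {p : ℝ} (hp : 0 < p)
    (hp1 : p ≤ 1) (hW : IsMixing d W p) (h : IsLocalPath g η K x c y N) :
    avgSq (mix W (y K) - fun _ => nodeMean (mix W (y K))) ≤
      (1 - p / 2) * avgSq (x - fun _ => nodeMean x)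
      + 9 / p * η ^ 2 * (K * ∑ l ∈ Finset.range K, avgSq (gradDev g (y l) (nodeMean x))
        + K ^ 2 * avgSq (trackErr g c (nodeMean x)) + avgSq (∑ l ∈ Finset.range K, N l)) := by
  set v := nodeMean x
  set B := ∑ l ∈ Finset.range K, gradDev g (y l) v + (K : ℝ) • trackErr g c v
      + ∑ l ∈ Finset.range K, N l with hB
  set q : Fin n → Vec d := (K : ℝ) • fun _ => nodeMean fun j => g j v with hq
  have hqm : nodeMean q = (K : ℝ) • nodeMean fun j => g j v := by
    rw [hq, nodeMean_smul, nodeMean_const hn]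
  have e : (y K - fun _ => nodeMean (y K)) =
      (x - fun _ => nodeMean x) + (-η) • (B - fun _ => nodeMean B) := by
    have e0 : y K = x - η • (B + q) := h.eq_sub le_rfl v
    have e1 : q = fun _ => nodeMean q := by rw [hqm]; rfl
    rw [e0, nodeMean_sub, nodeMean_smul, nodeMean_add]
    nth_rewrite 1 [e1]
    ext1 i
    simp only [Pi.sub_apply, Pi.add_apply, Pi.smul_apply]
    module
  rw [nodeMean_mix hW]
  have h1 := avgSq_mix_sub_mean_le hW (y K)
  have h2 := avgSq_add_le_young (θ := p / 2) (by positivity) (x - fun _ => nodeMean x)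
    ((-η) • (B - fun _ => nodeMean B))
  rw [← e, avgSq_smul, neg_sq] at h2
  have h3 := avgSq_sub_mean_le hn B
  have h4 := avgSq_add_three_le (∑ l ∈ Finset.range K, gradDev g (y l) v)
    ((K : ℝ) • trackErr g c v) (∑ l ∈ Finset.range K, N l)
  have h5 := avgSq_sum_le (Finset.range K) fun l => gradDev g (y l) v
  rw [avgSq_smul] at h4
  rw [Finset.card_range] at h5
  set R := (K * ∑ l ∈ Finset.range K, avgSq (gradDev g (y l) v)
        + K ^ 2 * avgSq (trackErr g c v) + avgSq (∑ l ∈ Finset.range K, N l))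
  have h6 : avgSq (B - fun _ => nodeMean B) ≤ 3 * R := by linarith
  have h7 : 0 ≤ avgSq (B - fun _ => nodeMean B) := avgSq_nonneg _
  -- With the factor 3 from splitting `B` into three terms, this gives the constant 9 / p.
  have h8 : (1 - p) * (1 + 1 / (p / 2)) ≤ 3 / p := by
    rw [show (1 - p) * (1 + 1 / (p / 2)) = ((1 - p) * (p + 2)) / p by field_simp]
    gcongr; nlinarith
  have hR : 0 ≤ R := by linarith
  have hη : 0 ≤ η ^ 2 := sq_nonneg η
  have hX := avgSq_nonneg (x - fun _ => nodeMean x)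
  calc avgSq (mix W (y K) - fun _ => nodeMean (y K))
      ≤ (1 - p) * avgSq (y K - fun _ => nodeMean (y K)) := h1
    _ ≤ (1 - p) * ((1 + p / 2) * avgSq (x - fun _ => nodeMean x)
        + (1 + 1 / (p / 2)) * (η ^ 2 * avgSq (B - fun _ => nodeMean B))) :=
        mul_le_mul_of_nonneg_left h2 (by linarith)
    _ = (1 - p) * (1 + p / 2) * avgSq (x - fun _ => nodeMean x)
        + (1 - p) * (1 + 1 / (p / 2)) * (η ^ 2 * avgSq (B - fun _ => nodeMean B)) := by ring
    _ ≤ (1 - p / 2) * avgSq (x - fun _ => nodeMean x) + 3 / p * (η ^ 2 * (3 * R)) := by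
        gcongr
        nlinarith
    _ = _ := by ring

/-- The average takes perturbed gradient steps for the global objective: corrections of mean zero
leave no trace in it. -/
theorem IsLocalPath.nodeMean_sub (hn : 1 ≤ n) (h : IsLocalPath g η K x c y N)
    (hc : nodeMean c = 0) :
    nodeMean (y K) - nodeMean x =
      -η • (nodeMean (∑ l ∈ Finset.range K, gradDev g (y l) (nodeMean x))
        + (K : ℝ) • (nodeMean fun j => g j (nodeMean x))
        + nodeMean (∑ l ∈ Finset.range K, N l)) := by
  rw [h.eq_sub le_rfl (nodeMean x), _root_.nodeMean_sub, nodeMean_smul, nodeMean_add, nodeMean_add,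
    nodeMean_add, nodeMean_smul, nodeMean_trackErr hn g hc, nodeMean_smul, nodeMean_const hn]
  module

theorem IsLocalPath.step_le (hn : 1 ≤ n) (h : IsLocalPath g η K x c y N) (hc : nodeMean c = 0) :
    ‖nodeMean (y K) - nodeMean x‖ ^ 2 ≤
      3 * η ^ 2 * (K * ∑ l ∈ Finset.range K, avgSq (gradDev g (y l) (nodeMean x))
        + K ^ 2 * ‖nodeMean fun j => g j (nodeMean x)‖ ^ 2
        + ‖nodeMean (∑ l ∈ Finset.range K, N l)‖ ^ 2) := by
  rw [h.nodeMean_sub hn hc, norm_smul, mul_pow, norm_neg, Real.norm_eq_abs, sq_abs]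
  set a := nodeMean (∑ l ∈ Finset.range K, gradDev g (y l) (nodeMean x)) with ha
  set b := nodeMean fun j => g j (nodeMean x)
  set e := nodeMean (∑ l ∈ Finset.range K, N l)
  have h1 := norm_add_sq_le_young (θ := 1 / 2) (by norm_num) (a + (K : ℝ) • b) e
  have h2 := norm_add_sq_le_young one_pos a ((K : ℝ) • b)
  rw [norm_smul, mul_pow, Real.norm_eq_abs, sq_abs] at h2
  norm_num at h1 h2
  have h3 := norm_nodeMean_sq_le hn (∑ l ∈ Finset.range K, gradDev g (y l) (nodeMean x))
  have h5 := avgSq_sum_le (Finset.range K) fun l => gradDev g (y l) (nodeMean x)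
  rw [Finset.card_range] at h5
  have h6 : ‖a + (K : ℝ) • b + e‖ ^ 2 ≤ 3 * (K * ∑ l ∈ Finset.range K,
      avgSq (gradDev g (y l) (nodeMean x)) + K ^ 2 * ‖b‖ ^ 2 + ‖e‖ ^ 2) := by linarith
  nlinarith [sq_nonneg η]

/-- The tracking error is the deviation of c + F from its mean, with F the gradients at `v`, so
mixing contracts it. What remains is (W − I)(h − F), where h − F is gradient deviation plus noise,
and the centred change F' − F of the reference gradients. -/
theorem trackErr_succ_le (hn : 1 ≤ n) {W : Matrix (Fin n) (Fin n) ℝ} {p L : ℝ} (hp : 0 < p)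
    (hp1 : p ≤ 1) (hW : IsMixing d W p) (hg : ∀ i x y, ‖g i x - g i y‖ ≤ L * ‖x - y‖)
    (hc : nodeMean c = 0) (Y M : Fin n → Vec d) (v v' : Vec d) {h : Fin n → Vec d}
    (hh : h = fun i => g i (Y i) + M i) :
    avgSq (trackErr g (mix W c + mix W h - h) v') ≤
      (1 - p / 2) * avgSq (trackErr g c v)
      + 6 / p * (8 * avgSq (gradDev g Y v) + 8 * avgSq M + L ^ 2 * ‖v' - v‖ ^ 2) := by
  set F : Fin n → Vec d := fun i => g i v with hF
  set F' : Fin n → Vec d := fun i => g i v' with hF'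
  have hcF : nodeMean (c + F) = nodeMean F := by rw [nodeMean_add, hc, zero_add]
  have ehF : h - F = gradDev g Y v + M := by
    ext1 i; simp only [hh, hF, gradDev, Pi.sub_apply, Pi.add_apply]; abel
  have e1 : trackErr g c v = (c + F) - fun _ => nodeMean (c + F) := by
    rw [hcF]; rfl
  have e2 : trackErr g (mix W c + mix W h - h) v' =
      (mix W (c + F) - fun _ => nodeMean (c + F))
      + ((mix W (h - F) - (h - F)) + ((F' - F) - fun _ => nodeMean (F' - F))) := by
    have : mix W h = mix W (h - F) + mix W F := by rw [← mix_add, sub_add_cancel]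
    rw [hcF, mix_add, this, _root_.nodeMean_sub]
    ext1 i
    simp only [trackErr, Pi.add_apply, Pi.sub_apply]
    change _ + F' i - nodeMean F' = _
    abel
  have h1 := avgSq_mix_sub_mean_le hW (c + F)
  rw [← e1] at h1
  have h2 := avgSq_add_le_young (θ := p / 2) (by positivity)
    (mix W (c + F) - fun _ => nodeMean (c + F))
    ((mix W (h - F) - (h - F)) + ((F' - F) - fun _ => nodeMean (F' - F)))
  rw [← e2] at h2
  have h3 := avgSq_add_le (mix W (h - F) - (h - F)) ((F' - F) - fun _ => nodeMean (F' - F))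
  have h4 := avgSq_sub_le (mix W (h - F)) (h - F)
  have h5 := avgSq_mix_le hn hp hW (h - F)
  have h6 := avgSq_add_le (gradDev g Y v) M
  rw [← ehF] at h6
  have h7 := avgSq_sub_mean_le hn (F' - F)
  have h8 : avgSq (F' - F) ≤ L ^ 2 * ‖v' - v‖ ^ 2 := by
    rw [← avgSq_const (n := n) hn (v' - v)]
    refine avgSq_le_of_le fun i => ?_
    rw [← mul_pow]
    exact pow_le_pow_left₀ (norm_nonneg _) (hg i _ _) 2
  set Q := avgSq ((mix W (h - F) - (h - F)) + ((F' - F) - fun _ => nodeMean (F' - F)))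
  set R := 8 * avgSq (gradDev g Y v) + 8 * avgSq M + L ^ 2 * ‖v' - v‖ ^ 2
  -- The weight 8 is 2 · 4: the factor 4 bounds W − I applied to h − F, and 2 splits h − F.
  have hQ : Q ≤ 2 * R := by linarith
  have hQ0 : 0 ≤ Q := avgSq_nonneg _
  have h9 : 1 + 1 / (p / 2) ≤ 3 / p := by
    rw [show 1 + 1 / (p / 2) = (p + 2) / p by field_simp]
    gcongr; linarith
  have hT := avgSq_nonneg (trackErr g c v)
  calc avgSq (trackErr g (mix W c + mix W h - h) v')
      ≤ (1 + p / 2) * ((1 - p) * avgSq (trackErr g c v)) + (1 + 1 / (p / 2)) * Q := by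
        refine h2.trans ?_
        gcongr
    _ ≤ (1 - p / 2) * avgSq (trackErr g c v) + 3 / p * (2 * R) := by
        rw [← mul_assoc]
        gcongr
        nlinarith
    _ = _ := by ring

end Round

/-! ### Square-integrable families -/

section SquareIntegrable

variable {d n : ℕ} {Ω : Type*} [MeasurableSpace Ω] {P : Measure Ω}

/-- Every node holds a square-integrable random vector. -/
def MemL2 (P : Measure Ω) (Y : Ω → Fin n → Vec d) : Prop :=
  ∀ i, MemLp (fun ω => Y ω i) 2 P

theorem MemL2.add {X Y : Ω → Fin n → Vec d} (hX : MemL2 P X) (hY : MemL2 P Y) :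
    MemL2 P fun ω => X ω + Y ω := fun i => (hX i).add (hY i)

theorem MemL2.sub {X Y : Ω → Fin n → Vec d} (hX : MemL2 P X) (hY : MemL2 P Y) :
    MemL2 P fun ω => X ω - Y ω := fun i => (hX i).sub (hY i)

theorem MemL2.sum {ι : Type*} (s : Finset ι) {Y : ι → Ω → Fin n → Vec d}
    (hY : ∀ l ∈ s, MemL2 P (Y l)) : MemL2 P fun ω => ∑ l ∈ s, Y l ω := fun i => by
  simp only [Finset.sum_apply]
  exact memLp_finsetSum s fun l hl => hY l hl i

theorem MemL2.nodeMean {Y : Ω → Fin n → Vec d} (hY : MemL2 P Y) :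
    MemLp (fun ω => nodeMean (Y ω)) 2 P :=
  (memLp_finsetSum Finset.univ fun i _ => hY i).const_smul (1 / (n : ℝ))

theorem MemL2.mix {Y : Ω → Fin n → Vec d} (hY : MemL2 P Y) (W : Matrix (Fin n) (Fin n) ℝ) :
    MemL2 P fun ω => mix W (Y ω) := fun i =>
  memLp_finsetSum Finset.univ fun j _ => (hY j).const_smul (W i j)

theorem MemL2.integrable_avgSq {Y : Ω → Fin n → Vec d} (hY : MemL2 P Y) :
    Integrable (fun ω => avgSq (Y ω)) P :=
  (integrable_finsetSum Finset.univ fun i _ => (hY i).integrable_norm_pow two_ne_zero).const_mul _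

/-- The increment g(Y) − g(0) is dominated by L‖Y‖, and constants are square-integrable for a finite
measure. -/
theorem MemLp.lipschitz_comp [IsFiniteMeasure P] {g : Vec d → Vec d} {L : ℝ}
    (hg : ∀ x y, ‖g x - g y‖ ≤ L * ‖x - y‖) {Y : Ω → Vec d} (hY : MemLp Y 2 P) :
    MemLp (fun ω => g (Y ω)) 2 P := by
  have hc : Continuous g :=
    (LipschitzWith.of_dist_le_mul (K := L.toNNReal) fun x y => by
      rw [dist_eq_norm, dist_eq_norm]
      exact (hg x y).trans (by gcongr; exact Real.le_coe_toNNReal L)).continuous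
  have h1 : MemLp (fun ω => g (Y ω) - g 0) 2 P := by
    refine MemLp.of_le_mul (c := L) hY ?_ ?_
    · exact (hc.comp_aestronglyMeasurable hY.1).sub aestronglyMeasurable_const
    · exact Filter.Eventually.of_forall fun ω => by simpa using hg (Y ω) 0
  have h2 := h1.add (memLp_const (g 0))
  refine h2.ae_eq (Filter.Eventually.of_forall fun ω => ?_)
  simp

theorem MemLp.integrable_normSq {E : Type*} [NormedAddCommGroup E] {Y : Ω → E}
    (hY : MemLp Y 2 P) : Integrable (fun ω => ‖Y ω‖ ^ 2) P :=
  hY.integrable_norm_pow two_ne_zero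

theorem MemLp.integrable_inner {E : Type*} [NormedAddCommGroup E] [InnerProductSpace ℝ E]
    {Y Z : Ω → E} (hY : MemLp Y 2 P) (hZ : MemLp Z 2 P) :
    Integrable (fun ω => inner ℝ (Y ω) (Z ω)) P := by
  refine ((MemLp.integrable_normSq hY).add (MemLp.integrable_normSq hZ)).mono'
    (hY.1.inner hZ.1) (Filter.Eventually.of_forall fun ω => ?_)
  have := norm_inner_le_norm (𝕜 := ℝ) (Y ω) (Z ω)
  simp only [Pi.add_apply]
  nlinarith [sq_nonneg (‖Y ω‖ - ‖Z ω‖), norm_nonneg (Y ω), norm_nonneg (Z ω)]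

/-- Pythagoras for finitely many uncorrelated random vectors. -/
theorem integral_norm_sum_sq {E ι : Type*} [NormedAddCommGroup E] [InnerProductSpace ℝ E]
    [DecidableEq ι] (s : Finset ι) {Z : ι → Ω → E} (hZ : ∀ a ∈ s, MemLp (Z a) 2 P)
    (ho : ∀ a ∈ s, ∀ b ∈ s, a ≠ b → ∫ ω, inner ℝ (Z a ω) (Z b ω) ∂P = 0) :
    ∫ ω, ‖∑ a ∈ s, Z a ω‖ ^ 2 ∂P = ∑ a ∈ s, ∫ ω, ‖Z a ω‖ ^ 2 ∂P := by
  induction s using Finset.induction_on with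
  | empty => simp
  | insert a s ha ih =>
    have hs : MemLp (fun ω => ∑ b ∈ s, Z b ω) 2 P :=
      memLp_finsetSum s fun b hb => hZ b (Finset.mem_insert_of_mem hb)
    have hZa := hZ a (Finset.mem_insert_self a s)
    have hin : ∀ b ∈ s, Integrable (fun ω => inner ℝ (Z a ω) (Z b ω)) P := fun b hb =>
      MemLp.integrable_inner hZa (hZ b (Finset.mem_insert_of_mem hb))
    simp only [Finset.sum_insert ha, norm_add_sq_real]
    rw [integral_add, integral_add, integral_const_mul,
      ih (fun b hb => hZ b (Finset.mem_insert_of_mem hb)) fun b hb b' hb' =>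
        ho b (Finset.mem_insert_of_mem hb) b' (Finset.mem_insert_of_mem hb')]
    · simp only [inner_sum]
      rw [integral_finsetSum s hin, Finset.sum_eq_zero fun b hb => ho a
        (Finset.mem_insert_self a s) b (Finset.mem_insert_of_mem hb) (by rintro rfl; exact ha hb)]
      ring
    · exact MemLp.integrable_normSq hZa
    · exact (MemLp.integrable_inner hZa hs).const_mul 2
    · exact (MemLp.integrable_normSq hZa).add ((MemLp.integrable_inner hZa hs).const_mul 2)
    · exact MemLp.integrable_normSq hs

end SquareIntegrable

/-! ### Smooth functions -/

/-- The quadratic upper bound for a function with a Lipschitz gradient. -/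
theorem le_quadratic_of_lipschitz_gradient {E : Type*} [NormedAddCommGroup E]
    [InnerProductSpace ℝ E] {f : E → ℝ} {G : E → E} [CompleteSpace E]
    {L : ℝ} (hf : ∀ x, HasGradientAt f (G x) x)
    (hG : ∀ x y, ‖G x - G y‖ ≤ L * ‖x - y‖) (x y : E) :
    f y ≤ f x + inner ℝ (G x) (y - x) + L / 2 * ‖y - x‖ ^ 2 := by
  -- The quadratic term is chosen so that the Lipschitz bound makes h' ≤ 0 on [0, 1]; comparing `h
  -- 1` with `h 0` is then the claim.
  set h : ℝ → ℝ := fun t =>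
    f (x + t • (y - x)) - t * inner ℝ (G x) (y - x) - L / 2 * t ^ 2 * ‖y - x‖ ^ 2 with hh
  have hd : ∀ t : ℝ, HasDerivAt h (inner ℝ (G (x + t • (y - x))) (y - x)
      - inner ℝ (G x) (y - x) - L * t * ‖y - x‖ ^ 2) t := fun t => by
    have h1 : HasDerivAt (fun t : ℝ => x + t • (y - x)) (y - x) t := by
      simpa using ((hasDerivAt_id t).smul_const (y - x)).const_add x
    have h2 := (hf (x + t • (y - x))).hasFDerivAt.comp_hasDerivAt t h1
    simp only [InnerProductSpace.toDual_apply_apply] at h2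
    have h3 : HasDerivAt (fun t : ℝ => t * inner ℝ (G x) (y - x)) (inner ℝ (G x) (y - x)) t := by
      simpa using (hasDerivAt_id t).mul_const (inner ℝ (G x) (y - x))
    have h4 : HasDerivAt (fun t : ℝ => L / 2 * t ^ 2 * ‖y - x‖ ^ 2) (L * t * ‖y - x‖ ^ 2) t := by
      have := ((hasDerivAt_pow 2 t).const_mul (L / 2)).mul_const (‖y - x‖ ^ 2)
      refine this.congr_deriv ?_
      push_cast
      ring
    exact (h2.sub h3).sub h4
  have hanti : AntitoneOn h (Set.Icc 0 1) := by
    refine antitoneOn_of_deriv_nonpos (convex_Icc 0 1)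
      (fun t _ => (hd t).continuousAt.continuousWithinAt)
      (fun t _ => (hd t).differentiableAt.differentiableWithinAt) fun t ht => ?_
    rw [interior_Icc] at ht
    rw [(hd t).deriv, ← inner_sub_left]
    have h5 := real_inner_le_norm (G (x + t • (y - x)) - G x) (y - x)
    have h6 := hG (x + t • (y - x)) x
    rw [add_sub_cancel_left, norm_smul, Real.norm_eq_abs, abs_of_pos ht.1] at h6
    nlinarith [norm_nonneg (y - x)]
  have := hanti (Set.left_mem_Icc.2 zero_le_one) (Set.right_mem_Icc.2 zero_le_one) zero_le_one
  simp only [hh] at this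
  simp at this
  linarith

/-! ### Gradient tracking with uncorrelated perturbations -/

/-- A run of gradient tracking: in round `t` the nodes start with models `x t` and corrections
`c t`, take `K` local steps to `y t K` with gradients perturbed by the uncorrelated, centred noise
`N t k`, and communicate over `W`. The noise has variance at most `σ²`, at the last local step,
whose gradients enter the corrections, at most `τ²`. -/
structure IsTrackingRun {d n : ℕ} {Ω : Type*} [MeasurableSpace Ω] (P : Measure Ω)
    (g : Fin n → Vec d → Vec d) (W : Matrix (Fin n) (Fin n) ℝ) (K : ℕ) (η σ τ : ℝ) (x0 : Vec d)
    (x c : ℕ → Ω → Fin n → Vec d) (y N : ℕ → ℕ → Ω → Fin n → Vec d) : Prop where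
  path : ∀ t ω, IsLocalPath g η K (x t ω) (c t ω) (fun k => y t k ω) fun k => N t k ω
  x_zero : ∀ ω, x 0 ω = fun _ => x0
  x_succ : ∀ t ω, x (t + 1) ω = mix W (y t K ω)
  c_zero : ∀ ω, nodeMean (c 0 ω) = 0
  c_succ : ∀ t ω, c (t + 1) ω = mix W (c t ω)
    + mix W (fun i => g i (y t (K - 1) ω i) + N t (K - 1) ω i)
    - fun i => g i (y t (K - 1) ω i) + N t (K - 1) ω i
  memL2_c : MemL2 P (c 0)
  memL2_N : ∀ t, ∀ k < K, MemL2 P (N t k)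
  variance_le : ∀ t, ∀ k < K, ∀ i, ∫ ω, ‖N t k ω i‖ ^ 2 ∂P ≤ σ ^ 2
  variance_last_le : ∀ t i, ∫ ω, ‖N t (K - 1) ω i‖ ^ 2 ∂P ≤ τ ^ 2
  uncorrelated : ∀ t, ∀ k < K, ∀ l < K, ∀ i j, (k, i) ≠ (l, j) →
    ∫ ω, inner ℝ (N t k ω i) (N t l ω j) ∂P = 0
  centred : ∀ t, ∀ k < K, ∀ i,
    ∫ ω, inner ℝ (nodeMean fun j => g j (nodeMean (x t ω))) (N t k ω i) ∂P = 0

/-! ### Accumulated noise and square integrability of the iterates -/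

namespace IsTrackingRun

variable {d n : ℕ} {Ω : Type*} [MeasurableSpace Ω] {P : Measure Ω}
  {g : Fin n → Vec d → Vec d} {W : Matrix (Fin n) (Fin n) ℝ} {K : ℕ} {L η σ τ p : ℝ} {x0 : Vec d}
  {x c : ℕ → Ω → Fin n → Vec d} {y N : ℕ → ℕ → Ω → Fin n → Vec d}

theorem nodeMean_c (h : IsTrackingRun P g W K η σ τ x0 x c y N) (hW : IsMixing d W p) (t : ℕ)
    (ω : Ω) : nodeMean (c t ω) = 0 := by
  induction t with
  | zero => exact h.c_zero ω
  | succ t ih => rw [h.c_succ, nodeMean_sub, nodeMean_add, nodeMean_mix hW, nodeMean_mix hW, ih]; simp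

theorem memL2_sum_N (h : IsTrackingRun P g W K η σ τ x0 x c y N) (t : ℕ) {k : ℕ} (hk : k ≤ K) :
    MemL2 P fun ω => ∑ l ∈ Finset.range k, N t l ω :=
  MemL2.sum _ fun l hl => h.memL2_N t l (by have := Finset.mem_range.1 hl; omega)

/-- Orthogonality over the local steps gives growth k instead of k², which becomes σ²/K after
normalising by K². -/
theorem integral_avgSq_sum_N_le (h : IsTrackingRun P g W K η σ τ x0 x c y N) (hn : 1 ≤ n) (t : ℕ)
    {k : ℕ} (hk : k ≤ K) : ∫ ω, avgSq (∑ l ∈ Finset.range k, N t l ω) ∂P ≤ k * σ ^ 2 := by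
  have hn0 : (0 : ℝ) < n := by positivity
  have hi : ∀ i, ∫ ω, ‖∑ l ∈ Finset.range k, N t l ω i‖ ^ 2 ∂P ≤ k * σ ^ 2 := fun i => by
    rw [integral_norm_sum_sq (Finset.range k) (Z := fun l ω => N t l ω i)]
    · calc _ ≤ ∑ _l ∈ Finset.range k, σ ^ 2 := Finset.sum_le_sum fun l hl =>
          h.variance_le t l (by have := Finset.mem_range.1 hl; omega) i
        _ = _ := by simp
    · exact fun l hl => h.memL2_N t l (by have := Finset.mem_range.1 hl; omega) i
    · intro l hl l' hl' hne
      have := Finset.mem_range.1 hl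
      have := Finset.mem_range.1 hl'
      exact h.uncorrelated t l (by omega) l' (by omega) i i (by simp [hne])
  simp only [avgSq, Finset.sum_apply]
  rw [integral_const_mul, integral_finsetSum]
  · calc _ ≤ 1 / (n : ℝ) * ∑ _i : Fin n, (k * σ ^ 2) := by gcongr with i; exact hi i
      _ = _ := by simp; field_simp
  · intro i _
    have := MemLp.integrable_normSq (h.memL2_sum_N t hk i)
    simpa only [Finset.sum_apply] using this

/-- Here orthogonality is used over steps and nodes jointly; the extra factor 1/n is the linear
speedup in n of the leading noise term. -/
theorem integral_norm_nodeMean_sum_N_le (h : IsTrackingRun P g W K η σ τ x0 x c y N) (hn : 1 ≤ n)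
    (t : ℕ) :
    ∫ ω, ‖nodeMean (∑ l ∈ Finset.range K, N t l ω)‖ ^ 2 ∂P ≤ K * σ ^ 2 / n := by
  have hn0 : (0 : ℝ) < n := by positivity
  have e : ∀ ω, ‖nodeMean (∑ l ∈ Finset.range K, N t l ω)‖ ^ 2 = (1 / (n : ℝ)) ^ 2 *
      ‖∑ q ∈ Finset.range K ×ˢ (Finset.univ : Finset (Fin n)), N t q.1 ω q.2‖ ^ 2 := fun ω => by
    rw [nodeMean, norm_smul, mul_pow, Real.norm_eq_abs, sq_abs, Finset.sum_product_right]
    simp only [Finset.sum_apply]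
  simp only [e]
  rw [integral_const_mul, integral_norm_sum_sq _ (Z := fun (q : ℕ × Fin n) ω => N t q.1 ω q.2)]
  · calc _ ≤ (1 / (n : ℝ)) ^ 2 *
          ∑ _q ∈ Finset.range K ×ˢ (Finset.univ : Finset (Fin n)), σ ^ 2 := by
          gcongr with q hq
          exact h.variance_le t q.1 (by simpa using hq) q.2
      _ = _ := by simp; field_simp
  · intro q hq
    exact h.memL2_N t q.1 (by simpa using hq) q.2
  · intro q hq q' hq' hne
    exact h.uncorrelated t q.1 (by simpa using hq) q'.1 (by simpa using hq') q.2 q'.2 hne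

variable [IsProbabilityMeasure P]

theorem memL2_y_of (h : IsTrackingRun P g W K η σ τ x0 x c y N)
    (hg : ∀ i x y, ‖g i x - g i y‖ ≤ L * ‖x - y‖) {t : ℕ} (hx : MemL2 P (x t))
    (hc : MemL2 P (c t)) {k : ℕ} (hk : k ≤ K) : MemL2 P (y t k) := by
  induction k with
  | zero =>
    have : y t 0 = x t := funext fun ω => (h.path t ω).zero
    rwa [this]
  | succ k ih =>
    intro i
    have := fun ω => (h.path t ω).succ k (by omega) i
    simp only [this]
    have hy := ih (by omega)
    exact (hy i).sub ((((MemLp.lipschitz_comp (hg i) (hy i)).add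
      (h.memL2_N t k (by omega) i)).add (hc i)).const_smul η)

theorem memL2_xc (h : IsTrackingRun P g W K η σ τ x0 x c y N) (hK : 1 ≤ K)
    (hg : ∀ i x y, ‖g i x - g i y‖ ≤ L * ‖x - y‖) (t : ℕ) : MemL2 P (x t) ∧ MemL2 P (c t) := by
  induction t with
  | zero =>
    refine ⟨fun i => ?_, h.memL2_c⟩
    simp only [h.x_zero]
    exact memLp_const x0
  | succ t ih =>
    have hy := fun k hk => h.memL2_y_of hg ih.1 ih.2 (k := k) hk
    have hh : MemL2 P fun ω => (fun i => g i (y t (K - 1) ω i) + N t (K - 1) ω i : Fin n → Vec d) :=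
      fun i => (MemLp.lipschitz_comp (hg i) (hy (K - 1) (by omega) i)).add
        (h.memL2_N t (K - 1) (by omega) i)
    constructor
    · rw [show x (t + 1) = fun ω => mix W (y t K ω) from funext (h.x_succ t)]
      exact (hy K le_rfl).mix W
    · rw [show c (t + 1) = _ from funext (h.c_succ t)]
      exact ((ih.2.mix W).add (hh.mix W)).sub hh

theorem memL2_x (h : IsTrackingRun P g W K η σ τ x0 x c y N) (hK : 1 ≤ K)
    (hg : ∀ i x y, ‖g i x - g i y‖ ≤ L * ‖x - y‖) (t : ℕ) : MemL2 P (x t) :=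
  (h.memL2_xc hK hg t).1

theorem memL2_y (h : IsTrackingRun P g W K η σ τ x0 x c y N) (hK : 1 ≤ K)
    (hg : ∀ i x y, ‖g i x - g i y‖ ≤ L * ‖x - y‖) (t : ℕ) {k : ℕ} (hk : k ≤ K) :
    MemL2 P (y t k) :=
  h.memL2_y_of hg (h.memL2_xc hK hg t).1 (h.memL2_xc hK hg t).2 hk

theorem memL2_consensus (h : IsTrackingRun P g W K η σ τ x0 x c y N) (hK : 1 ≤ K)
    (hg : ∀ i x y, ‖g i x - g i y‖ ≤ L * ‖x - y‖) (t : ℕ) :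
    MemL2 P fun ω => x t ω - fun _ => nodeMean (x t ω) :=
  (h.memL2_x hK hg t).sub fun _ => (h.memL2_x hK hg t).nodeMean

theorem memLp_grad (h : IsTrackingRun P g W K η σ τ x0 x c y N) (hK : 1 ≤ K)
    (hg : ∀ i x y, ‖g i x - g i y‖ ≤ L * ‖x - y‖) (t : ℕ) (i : Fin n) :
    MemLp (fun ω => g i (nodeMean (x t ω))) 2 P :=
  MemLp.lipschitz_comp (hg i) (h.memL2_x hK hg t).nodeMean

theorem memLp_meanGrad (h : IsTrackingRun P g W K η σ τ x0 x c y N) (hK : 1 ≤ K)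
    (hg : ∀ i x y, ‖g i x - g i y‖ ≤ L * ‖x - y‖) (t : ℕ) :
    MemLp (fun ω => nodeMean fun j => g j (nodeMean (x t ω))) 2 P :=
  MemL2.nodeMean (Y := fun ω j => g j (nodeMean (x t ω))) fun i => h.memLp_grad hK hg t i

theorem memL2_trackErr (h : IsTrackingRun P g W K η σ τ x0 x c y N) (hK : 1 ≤ K)
    (hg : ∀ i x y, ‖g i x - g i y‖ ≤ L * ‖x - y‖) (t : ℕ) :
    MemL2 P fun ω => trackErr g (c t ω) (nodeMean (x t ω)) := fun i =>
  (((h.memL2_xc hK hg t).2 i).add (h.memLp_grad hK hg t i)).sub (h.memLp_meanGrad hK hg t)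

theorem memL2_gradDev (h : IsTrackingRun P g W K η σ τ x0 x c y N) (hK : 1 ≤ K)
    (hg : ∀ i x y, ‖g i x - g i y‖ ≤ L * ‖x - y‖) (t : ℕ) {k : ℕ} (hk : k ≤ K) :
    MemL2 P fun ω => gradDev g (y t k ω) (nodeMean (x t ω)) := fun i =>
  (MemLp.lipschitz_comp (hg i) (h.memL2_y hK hg t hk i)).sub (h.memLp_grad hK hg t i)

end IsTrackingRun

/-! ### The coupled error recursions in expectation -/

section Errors

variable {d n : ℕ} {Ω : Type*} [MeasurableSpace Ω]

/-- Expected mean-square distance of the models to their average. -/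
def consensusErr (P : Measure Ω) (x : ℕ → Ω → Fin n → Vec d) (t : ℕ) : ℝ :=
  ∫ ω, avgSq (x t ω - fun _ => nodeMean (x t ω)) ∂P

/-- Expected mean-square error of the corrections at the average model. -/
def correctionErr (P : Measure Ω) (g : Fin n → Vec d → Vec d) (x c : ℕ → Ω → Fin n → Vec d)
    (t : ℕ) : ℝ :=
  ∫ ω, avgSq (trackErr g (c t ω) (nodeMean (x t ω))) ∂P

/-- Expected squared norm of the averaged gradient at the average model. -/
def gradSq (P : Measure Ω) (g : Fin n → Vec d → Vec d) (x : ℕ → Ω → Fin n → Vec d) (t : ℕ) : ℝ :=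
  ∫ ω, ‖nodeMean fun j => g j (nodeMean (x t ω))‖ ^ 2 ∂P

/-- The bound for the drift during the local steps of round `t`. -/
def driftBound (P : Measure Ω) (g : Fin n → Vec d → Vec d) (x c : ℕ → Ω → Fin n → Vec d)
    (K : ℕ) (L η σ : ℝ) (t : ℕ) : ℝ :=
  8 * (K * L * η) ^ 2 * (2 * (L ^ 2 * consensusErr P x t) + correctionErr P g x c t
    + gradSq P g x t + σ ^ 2 / K)

end Errors

namespace IsTrackingRun

variable {d n : ℕ} {Ω : Type*} [MeasurableSpace Ω] {P : Measure Ω}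
  {g : Fin n → Vec d → Vec d} {W : Matrix (Fin n) (Fin n) ℝ} {K : ℕ} {L η σ τ p : ℝ} {x0 : Vec d}
  {x c : ℕ → Ω → Fin n → Vec d} {y N : ℕ → ℕ → Ω → Fin n → Vec d}

theorem consensusErr_nonneg (t : ℕ) : 0 ≤ consensusErr P x t :=
  integral_nonneg fun _ => avgSq_nonneg _

theorem correctionErr_nonneg (t : ℕ) : 0 ≤ correctionErr P g x c t :=
  integral_nonneg fun _ => avgSq_nonneg _

theorem gradSq_nonneg (t : ℕ) : 0 ≤ gradSq P g x t :=
  integral_nonneg fun _ => sq_nonneg _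

theorem nodeMean_succ (h : IsTrackingRun P g W K η σ τ x0 x c y N) (hW : IsMixing d W p) (t : ℕ)
    (ω : Ω) : nodeMean (x (t + 1) ω) = nodeMean (y t K ω) := by
  rw [h.x_succ, nodeMean_mix hW]

theorem integrable_sum_N (h : IsTrackingRun P g W K η σ τ x0 x c y N) (t : ℕ) {k : ℕ}
    (hk : k ≤ K) : Integrable (fun ω => avgSq (∑ l ∈ Finset.range k, N t l ω)) P :=
  (h.memL2_sum_N t hk).integrable_avgSq

variable [IsProbabilityMeasure P]

theorem integrable_consensus (h : IsTrackingRun P g W K η σ τ x0 x c y N) (hK : 1 ≤ K)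
    (hg : ∀ i x y, ‖g i x - g i y‖ ≤ L * ‖x - y‖) (t : ℕ) :
    Integrable (fun ω => avgSq (x t ω - fun _ => nodeMean (x t ω))) P :=
  (h.memL2_consensus hK hg t).integrable_avgSq

theorem integrable_gradDev (h : IsTrackingRun P g W K η σ τ x0 x c y N) (hK : 1 ≤ K)
    (hg : ∀ i x y, ‖g i x - g i y‖ ≤ L * ‖x - y‖) (t : ℕ) {k : ℕ} (hk : k ≤ K) :
    Integrable (fun ω => avgSq (gradDev g (y t k ω) (nodeMean (x t ω)))) P :=
  (h.memL2_gradDev hK hg t hk).integrable_avgSq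

theorem integrable_sum_gradDev (h : IsTrackingRun P g W K η σ τ x0 x c y N) (hK : 1 ≤ K)
    (hg : ∀ i x y, ‖g i x - g i y‖ ≤ L * ‖x - y‖) (t : ℕ) {k : ℕ} (hk : k ≤ K) :
    Integrable (fun ω => ∑ l ∈ Finset.range k,
      avgSq (gradDev g (y t l ω) (nodeMean (x t ω)))) P :=
  integrable_finsetSum _ fun l hl =>
    h.integrable_gradDev hK hg t (by have := Finset.mem_range.1 hl; omega)

theorem integral_sum_gradDev (h : IsTrackingRun P g W K η σ τ x0 x c y N) (hK : 1 ≤ K)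
    (hg : ∀ i x y, ‖g i x - g i y‖ ≤ L * ‖x - y‖) (t : ℕ) {k : ℕ} (hk : k ≤ K) :
    ∫ ω, ∑ l ∈ Finset.range k, avgSq (gradDev g (y t l ω) (nodeMean (x t ω))) ∂P =
      ∑ l ∈ Finset.range k, ∫ ω, avgSq (gradDev g (y t l ω) (nodeMean (x t ω))) ∂P :=
  integral_finsetSum _ fun l hl =>
    h.integrable_gradDev hK hg t (by have := Finset.mem_range.1 hl; omega)

theorem integrable_trackErr (h : IsTrackingRun P g W K η σ τ x0 x c y N) (hK : 1 ≤ K)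
    (hg : ∀ i x y, ‖g i x - g i y‖ ≤ L * ‖x - y‖) (t : ℕ) :
    Integrable (fun ω => avgSq (trackErr g (c t ω) (nodeMean (x t ω)))) P :=
  (h.memL2_trackErr hK hg t).integrable_avgSq

theorem integrable_meanGrad (h : IsTrackingRun P g W K η σ τ x0 x c y N) (hK : 1 ≤ K)
    (hg : ∀ i x y, ‖g i x - g i y‖ ≤ L * ‖x - y‖) (t : ℕ) :
    Integrable (fun ω => ‖nodeMean fun j => g j (nodeMean (x t ω))‖ ^ 2) P :=
  MemLp.integrable_normSq (h.memLp_meanGrad hK hg t)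

theorem integrable_step (h : IsTrackingRun P g W K η σ τ x0 x c y N) (hK : 1 ≤ K)
    (hg : ∀ i x y, ‖g i x - g i y‖ ≤ L * ‖x - y‖) (t : ℕ) :
    Integrable (fun ω => ‖nodeMean (x (t + 1) ω) - nodeMean (x t ω)‖ ^ 2) P :=
  MemLp.integrable_normSq ((h.memL2_x hK hg (t + 1)).nodeMean.sub (h.memL2_x hK hg t).nodeMean)

theorem integral_gradDev_le (h : IsTrackingRun P g W K η σ τ x0 x c y N) (hK : 1 ≤ K)
    (hg : ∀ i x y, ‖g i x - g i y‖ ≤ L * ‖x - y‖) (t : ℕ) {k : ℕ} (hk : k ≤ K) :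
    ∫ ω, avgSq (gradDev g (y t k ω) (nodeMean (x t ω))) ∂P ≤
      2 * (L ^ 2 * ∫ ω, avgSq (y t k ω - x t ω) ∂P + L ^ 2 * consensusErr P x t) := by
  have hI := ((h.memL2_y hK hg t hk).sub (h.memL2_x hK hg t)).integrable_avgSq
  have h1 := integral_mono (h.integrable_gradDev hK hg t hk)
    ((hI.add (h.integrable_consensus hK hg t)).const_mul (2 * L ^ 2))
    fun ω => avgSq_gradDev_le_drift hg (x t ω) (y t k ω) (nodeMean (x t ω))
  rw [integral_const_mul, integral_add' hI (h.integrable_consensus hK hg t)] at h1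
  rw [consensusErr]
  linarith

/-- Gradient deviations at step k are controlled by the drifts at earlier steps, so strong induction
closes with a bound independent of k. If all earlier drifts are at most m, the new one is at most
8(KLη)²m + m/2, and the stepsize condition makes the first term at most m/2. -/
theorem drift_le (h : IsTrackingRun P g W K η σ τ x0 x c y N) (hn : 1 ≤ n) (hK : 1 ≤ K)
    (hg : ∀ i x y, ‖g i x - g i y‖ ≤ L * ‖x - y‖) (hu : 16 * (K * L * η) ^ 2 ≤ 1) (t : ℕ) {k : ℕ}
    (hk : k ≤ K) :
    L ^ 2 * ∫ ω, avgSq (y t k ω - x t ω) ∂P ≤ driftBound P g x c K L η σ t := by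
  induction k using Nat.strong_induction_on with
  | _ k ih =>
  have hI := ((h.memL2_y hK hg t hk).sub (h.memL2_x hK hg t)).integrable_avgSq
  have i1 := (h.integrable_sum_gradDev hK hg t hk).const_mul (k : ℝ)
  have i2 := (h.integrable_trackErr hK hg t).const_mul ((k : ℝ) ^ 2)
  have i3 := h.integrable_sum_N t hk
  have i4 := (h.integrable_meanGrad hK hg t).const_mul ((k : ℝ) ^ 2)
  have h1 := integral_mono hI ((((i1.add i2).add i3).add i4).const_mul (4 * η ^ 2))
    fun ω => (h.path t ω).drift_le hn hk (nodeMean (x t ω))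
  rw [integral_const_mul, integral_add' ((i1.add i2).add i3) i4, integral_add' (i1.add i2) i3,
    integral_add' i1 i2, integral_const_mul, integral_const_mul, integral_const_mul,
    h.integral_sum_gradDev hK hg t hk] at h1
  have h2 := h.integral_avgSq_sum_N_le hn t hk
  set m := driftBound P g x c K L η σ t with hm
  have hΔ : 0 ≤ consensusErr P x t := consensusErr_nonneg t
  have hΓ : 0 ≤ correctionErr P g x c t := correctionErr_nonneg t
  have hG : 0 ≤ gradSq P g x t := gradSq_nonneg t
  have hm0 : 0 ≤ m := by rw [hm, driftBound]; positivity
  have h3 : ∑ l ∈ Finset.range k, ∫ ω, avgSq (gradDev g (y t l ω) (nodeMean (x t ω))) ∂P ≤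
      k * (2 * (m + L ^ 2 * consensusErr P x t)) := by
    calc _ ≤ ∑ _l ∈ Finset.range k, 2 * (m + L ^ 2 * consensusErr P x t) := by
          gcongr with l hl
          have hl' := Finset.mem_range.1 hl
          refine (h.integral_gradDev_le hK hg t (by omega)).trans ?_
          linarith [ih l hl' (by omega)]
      _ = _ := by simp
  have hkK : (k : ℝ) ≤ K := by exact_mod_cast hk
  have hk0 : (0 : ℝ) ≤ k := by positivity
  have hK0 : (0 : ℝ) < K := by exact_mod_cast hK
  have h4 : ∫ ω, avgSq (y t k ω - x t ω) ∂P ≤ 4 * η ^ 2 * (K * (K * (2 * (m + L ^ 2 *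
      consensusErr P x t))) + K ^ 2 * correctionErr P g x c t + K * σ ^ 2
      + K ^ 2 * gradSq P g x t) := by
    refine h1.trans (mul_le_mul_of_nonneg_left ?_ (by positivity))
    have e1 : (k : ℝ) * ∑ l ∈ Finset.range k,
        ∫ ω, avgSq (gradDev g (y t l ω) (nodeMean (x t ω))) ∂P ≤
        K * (K * (2 * (m + L ^ 2 * consensusErr P x t))) := by
      refine mul_le_mul hkK (h3.trans (by gcongr)) ?_ hK0.le
      exact Finset.sum_nonneg fun l _ => integral_nonneg fun _ => avgSq_nonneg _
    have e2 : (k : ℝ) ^ 2 * correctionErr P g x c t ≤ K ^ 2 * correctionErr P g x c t := by gcongr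
    have e3 : (k : ℝ) ^ 2 * gradSq P g x t ≤ K ^ 2 * gradSq P g x t := by gcongr
    have e4 : (k : ℝ) * σ ^ 2 ≤ K * σ ^ 2 := by gcongr
    unfold correctionErr gradSq at *
    linarith
  calc L ^ 2 * ∫ ω, avgSq (y t k ω - x t ω) ∂P
      ≤ L ^ 2 * (4 * η ^ 2 * (K * (K * (2 * (m + L ^ 2 * consensusErr P x t)))
        + K ^ 2 * correctionErr P g x c t + K * σ ^ 2 + K ^ 2 * gradSq P g x t)) := by gcongr
    _ = 8 * (K * L * η) ^ 2 * m + (4 * (K * L * η) ^ 2 * (2 * (L ^ 2 * consensusErr P x t)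
        + correctionErr P g x c t + gradSq P g x t + σ ^ 2 / K)) := by
        field_simp; ring
    _ = 8 * (K * L * η) ^ 2 * m + m / 2 := by rw [hm, driftBound]; ring
    _ ≤ m := by nlinarith

theorem gradDev_le (h : IsTrackingRun P g W K η σ τ x0 x c y N) (hn : 1 ≤ n) (hK : 1 ≤ K)
    (hg : ∀ i x y, ‖g i x - g i y‖ ≤ L * ‖x - y‖) (hu : 16 * (K * L * η) ^ 2 ≤ 1) (t : ℕ) {k : ℕ}
    (hk : k ≤ K) :
    ∫ ω, avgSq (gradDev g (y t k ω) (nodeMean (x t ω))) ∂P ≤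
      2 * (driftBound P g x c K L η σ t + L ^ 2 * consensusErr P x t) := by
  linarith [h.integral_gradDev_le hK hg t hk, h.drift_le hn hK hg hu t hk]

theorem sum_gradDev_le (h : IsTrackingRun P g W K η σ τ x0 x c y N) (hn : 1 ≤ n) (hK : 1 ≤ K)
    (hg : ∀ i x y, ‖g i x - g i y‖ ≤ L * ‖x - y‖) (hu : 16 * (K * L * η) ^ 2 ≤ 1) (t : ℕ) :
    ∫ ω, ∑ l ∈ Finset.range K, avgSq (gradDev g (y t l ω) (nodeMean (x t ω))) ∂P ≤
      K * (2 * (driftBound P g x c K L η σ t + L ^ 2 * consensusErr P x t)) := by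
  rw [h.integral_sum_gradDev hK hg t le_rfl]
  calc _ ≤ ∑ _l ∈ Finset.range K,
        2 * (driftBound P g x c K L η σ t + L ^ 2 * consensusErr P x t) := by
        gcongr with l hl
        exact h.gradDev_le hn hK hg hu t (Finset.mem_range.1 hl).le
    _ = _ := by simp

theorem consensusErr_succ_le (h : IsTrackingRun P g W K η σ τ x0 x c y N) (hn : 1 ≤ n)
    (hK : 1 ≤ K) (hp : 0 < p) (hp1 : p ≤ 1) (hW : IsMixing d W p)
    (hg : ∀ i x y, ‖g i x - g i y‖ ≤ L * ‖x - y‖) (hu : 16 * (K * L * η) ^ 2 ≤ 1) (t : ℕ) :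
    L ^ 2 * consensusErr P x (t + 1) ≤ (1 - p / 2) * (L ^ 2 * consensusErr P x t)
      + 9 / p * (K * L * η) ^ 2 * (2 * driftBound P g x c K L η σ t
        + 2 * (L ^ 2 * consensusErr P x t) + correctionErr P g x c t + σ ^ 2 / K) := by
  have i0 := (h.integrable_consensus hK hg t).const_mul (1 - p / 2)
  have i1 := (h.integrable_sum_gradDev hK hg t le_rfl).const_mul (K : ℝ)
  have i2 := (h.integrable_trackErr hK hg t).const_mul ((K : ℝ) ^ 2)
  have i3 := h.integrable_sum_N t le_rfl
  have i4 := ((i1.add i2).add i3).const_mul (9 / p * η ^ 2)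
  have hpt := fun ω => (h.path t ω).consensus_le hn hp hp1 hW
  simp only [← h.x_succ] at hpt
  have h1 := integral_mono (h.integrable_consensus hK hg (t + 1)) (i0.add i4) hpt
  rw [integral_add' i0 i4, integral_const_mul, integral_const_mul, integral_add' (i1.add i2) i3,
    integral_add' i1 i2, integral_const_mul, integral_const_mul] at h1
  have h2 := h.integral_avgSq_sum_N_le hn t le_rfl
  have h3 := h.sum_gradDev_le hn hK hg hu t
  have hK0 : (0 : ℝ) < K := by exact_mod_cast hK
  set m := driftBound P g x c K L η σ t
  change consensusErr P x (t + 1) ≤ (1 - p / 2) * consensusErr P x t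
    + 9 / p * η ^ 2 * (K * _ + K ^ 2 * correctionErr P g x c t + _) at h1
  calc L ^ 2 * consensusErr P x (t + 1)
      ≤ L ^ 2 * ((1 - p / 2) * consensusErr P x t + 9 / p * η ^ 2 *
        (K * (K * (2 * (m + L ^ 2 * consensusErr P x t))) + K ^ 2 * correctionErr P g x c t
          + K * σ ^ 2)) := by
        refine mul_le_mul_of_nonneg_left (h1.trans ?_) (sq_nonneg L)
        gcongr
    _ = _ := by field_simp

theorem step_le (h : IsTrackingRun P g W K η σ τ x0 x c y N) (hn : 1 ≤ n)
    (hK : 1 ≤ K) (hW : IsMixing d W p)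
    (hg : ∀ i x y, ‖g i x - g i y‖ ≤ L * ‖x - y‖) (hu : 16 * (K * L * η) ^ 2 ≤ 1) (t : ℕ) :
    L ^ 2 * ∫ ω, ‖nodeMean (x (t + 1) ω) - nodeMean (x t ω)‖ ^ 2 ∂P ≤
      3 * (K * L * η) ^ 2 * (2 * driftBound P g x c K L η σ t
        + 2 * (L ^ 2 * consensusErr P x t) + gradSq P g x t + σ ^ 2 / (K * n)) := by
  have i1 := (h.integrable_sum_gradDev hK hg t le_rfl).const_mul (K : ℝ)
  have i2 := (h.integrable_meanGrad hK hg t).const_mul ((K : ℝ) ^ 2)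
  have i3 := MemLp.integrable_normSq (h.memL2_sum_N t (le_refl K)).nodeMean
  have hpt := fun ω => (h.path t ω).step_le hn (h.nodeMean_c hW t ω)
  simp only [← h.nodeMean_succ hW] at hpt
  have h1 := integral_mono (h.integrable_step hK hg t)
    (((i1.add i2).add i3).const_mul (3 * η ^ 2)) hpt
  rw [integral_const_mul, integral_add' (i1.add i2) i3,
    integral_add' i1 i2, integral_const_mul, integral_const_mul] at h1
  have h2 := h.integral_norm_nodeMean_sum_N_le hn t
  have h3 := h.sum_gradDev_le hn hK hg hu t
  have hK0 : (0 : ℝ) < K := by exact_mod_cast hK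
  have hn0 : (0 : ℝ) < n := by exact_mod_cast hn
  set m := driftBound P g x c K L η σ t
  change _ ≤ 3 * η ^ 2 * (K * _ + K ^ 2 * gradSq P g x t + _) at h1
  calc L ^ 2 * ∫ ω, ‖nodeMean (x (t + 1) ω) - nodeMean (x t ω)‖ ^ 2 ∂P
      ≤ L ^ 2 * (3 * η ^ 2 *
        (K * (K * (2 * (m + L ^ 2 * consensusErr P x t))) + K ^ 2 * gradSq P g x t
          + K * σ ^ 2 / n)) := by
        refine mul_le_mul_of_nonneg_left (h1.trans ?_) (sq_nonneg L)
        gcongr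
    _ = _ := by field_simp

theorem correctionErr_succ_le (h : IsTrackingRun P g W K η σ τ x0 x c y N) (hn : 1 ≤ n)
    (hK : 1 ≤ K) (hp : 0 < p) (hp1 : p ≤ 1) (hW : IsMixing d W p)
    (hg : ∀ i x y, ‖g i x - g i y‖ ≤ L * ‖x - y‖) (hu : 16 * (K * L * η) ^ 2 ≤ 1) (t : ℕ) :
    correctionErr P g x c (t + 1) ≤ (1 - p / 2) * correctionErr P g x c t
      + 6 / p * (17 * driftBound P g x c K L η σ t + 17 * (L ^ 2 * consensusErr P x t) + 8 * τ ^ 2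
        + 3 * (K * L * η) ^ 2 * (gradSq P g x t + σ ^ 2 / K)) := by
  have i0 := (h.integrable_trackErr hK hg t).const_mul (1 - p / 2)
  have i1 := (h.integrable_gradDev hK hg t (k := K - 1) (by omega)).const_mul 8
  have hN := h.memL2_N t (K - 1) (by omega)
  have i2 := hN.integrable_avgSq.const_mul 8
  have i3 := (h.integrable_step hK hg t).const_mul (L ^ 2)
  have i4 := ((i1.add i2).add i3).const_mul (6 / p)
  have h1 := integral_mono (h.integrable_trackErr hK hg (t + 1)) (i0.add i4) fun ω => by
    rw [h.c_succ]
    exact trackErr_succ_le hn hp hp1 hW hg (h.nodeMean_c hW t ω) (y t (K - 1) ω) (N t (K - 1) ω)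
      (nodeMean (x t ω)) (nodeMean (x (t + 1) ω)) rfl
  rw [integral_add' i0 i4, integral_const_mul, integral_const_mul, integral_add' (i1.add i2) i3,
    integral_add' i1 i2, integral_const_mul, integral_const_mul, integral_const_mul] at h1
  have hK0 : (0 : ℝ) < K := by exact_mod_cast hK
  have hn0 : (0 : ℝ) < n := by exact_mod_cast hn
  have h2 : ∫ ω, avgSq (N t (K - 1) ω) ∂P ≤ τ ^ 2 := by
    simp only [avgSq]
    rw [integral_const_mul, integral_finsetSum _ fun i _ => MemLp.integrable_normSq (hN i)]
    calc _ ≤ 1 / (n : ℝ) * ∑ _i : Fin n, τ ^ 2 := by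
          gcongr with i; exact h.variance_last_le t i
      _ = _ := by simp; field_simp
  have h3 := h.gradDev_le hn hK hg hu t (k := K - 1) (by omega)
  have h4 := h.step_le hn hK hW hg hu t
  set m := driftBound P g x c K L η σ t with hm
  have hΔ : 0 ≤ consensusErr P x t := consensusErr_nonneg t
  have hΓ : 0 ≤ correctionErr P g x c t := correctionErr_nonneg t
  have hG : 0 ≤ gradSq P g x t := gradSq_nonneg t
  have hm0 : 0 ≤ m := by rw [hm, driftBound]; positivity
  change correctionErr P g x c (t + 1) ≤ (1 - p / 2) * correctionErr P g x c t + _ at h1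
  refine h1.trans (add_le_add_right (mul_le_mul_of_nonneg_left ?_ (by positivity)) _)
  have h5 : σ ^ 2 / (K * n) ≤ σ ^ 2 / K := by
    gcongr
    exact le_mul_of_one_le_right hK0.le (by exact_mod_cast hn)
  have h6 : 3 * (K * L * η) ^ 2 * (2 * m + 2 * (L ^ 2 * consensusErr P x t) + gradSq P g x t
      -- The movement of the average contributes only one more copy of m and of the consensus term,
      -- whence 17 = 8 · 2 + 1.
      + σ ^ 2 / (K * n)) ≤ m + L ^ 2 * consensusErr P x t
        + 3 * (K * L * η) ^ 2 * (gradSq P g x t + σ ^ 2 / K) := by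
    have : 6 * (K * L * η) ^ 2 * (m + L ^ 2 * consensusErr P x t) ≤
        1 * (m + L ^ 2 * consensusErr P x t) := by
      gcongr; linarith
    have : 3 * (K * L * η) ^ 2 * (σ ^ 2 / (K * n)) ≤ 3 * (K * L * η) ^ 2 * (σ ^ 2 / K) := by
      gcongr
    linarith
  linarith

/-- The objective lies between its lower bound and a quadratic function of a square-integrable
vector. -/
theorem integrable_objective (h : IsTrackingRun P g W K η σ τ x0 x c y N) (hK : 1 ≤ K)
    (hg : ∀ i x y, ‖g i x - g i y‖ ≤ L * ‖x - y‖) {f : Vec d → ℝ} {fmin : ℝ}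
    (hquad : ∀ x y, f y ≤ f x + inner ℝ (nodeMean fun j => g j x) (y - x) + L / 2 * ‖y - x‖ ^ 2)
    (hfc : Continuous f) (hmin : ∀ x, fmin ≤ f x) (t : ℕ) :
    Integrable (fun ω => f (nodeMean (x t ω))) P := by
  have hx := (h.memL2_x hK hg t).nodeMean
  have i1 : Integrable (fun ω => f 0 + inner ℝ (nodeMean fun j => g j 0) (nodeMean (x t ω))
      + L / 2 * ‖nodeMean (x t ω)‖ ^ 2) P :=
    ((integrable_const (f 0)).add ((hx.integrable one_le_two).const_inner _)).add
      ((MemLp.integrable_normSq hx).const_mul (L / 2))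
  refine ((integrable_const |fmin|).add i1.abs).mono'
    (hfc.comp_aestronglyMeasurable hx.1) (Filter.Eventually.of_forall fun ω => ?_)
  have h1 := hquad 0 (nodeMean (x t ω))
  simp only [sub_zero] at h1
  have h2 := hmin (nodeMean (x t ω))
  simp only [Pi.add_apply, Real.norm_eq_abs]
  set B := f 0 + inner ℝ (nodeMean fun j => g j 0) (nodeMean (x t ω))
      + L / 2 * ‖nodeMean (x t ω)‖ ^ 2
  rw [abs_le]
  constructor <;> linarith [neg_abs_le fmin, le_abs_self B, abs_nonneg B, abs_nonneg fmin]

/-- The quadratic upper bound is applied to the movement of the average over a whole round. The term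
linear in the noise has expectation zero, so noise enters only through the squared step, with
variance σ²/(Kn). Of the gain ηK‖∇f‖², one half pays for the gradient deviations and one eighth for
the squared step, leaving 3/8. -/
theorem descent (h : IsTrackingRun P g W K η σ τ x0 x c y N) (hn : 1 ≤ n)
    (hK : 1 ≤ K) (hL : 0 < L) (hη : 0 < η) (hW : IsMixing d W p)
    (hg : ∀ i x y, ‖g i x - g i y‖ ≤ L * ‖x - y‖) (hu : 12 * (K * L * η) ≤ 1)
    {f : Vec d → ℝ} {fmin : ℝ}
    (hquad : ∀ x y, f y ≤ f x + inner ℝ (nodeMean fun j => g j x) (y - x) + L / 2 * ‖y - x‖ ^ 2)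
    (hfc : Continuous f) (hmin : ∀ x, fmin ≤ f x) (t : ℕ) :
    ∫ ω, f (nodeMean (x (t + 1) ω)) ∂P ≤ ∫ ω, f (nodeMean (x t ω)) ∂P
      + η * K * (-(3 / 8) * gradSq P g x t
        + 2 * (driftBound P g x c K L η σ t + L ^ 2 * consensusErr P x t)
        + 2 * (K * L * η) * (σ ^ 2 / (K * n))) := by
  have hK0 : (0 : ℝ) < K := by exact_mod_cast hK
  have hn0 : (0 : ℝ) < n := by exact_mod_cast hn
  have hu0 : 0 < K * L * η := by positivity
  have hu2 : 16 * (K * L * η) ^ 2 ≤ 1 := by nlinarith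
  have hpt : ∀ ω, f (nodeMean (x (t + 1) ω)) ≤ f (nodeMean (x t ω))
      + -(η * K / 2) * ‖nodeMean fun j => g j (nodeMean (x t ω))‖ ^ 2
      + η / 2 * ∑ l ∈ Finset.range K, avgSq (gradDev g (y t l ω) (nodeMean (x t ω)))
      + -η * inner ℝ (nodeMean fun j => g j (nodeMean (x t ω)))
          (nodeMean (∑ l ∈ Finset.range K, N t l ω))
      + L / 2 * ‖nodeMean (x (t + 1) ω) - nodeMean (x t ω)‖ ^ 2 := fun ω => by
    have h1 := hquad (nodeMean (x t ω)) (nodeMean (x (t + 1) ω))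
    have h2 := (h.path t ω).nodeMean_sub hn (h.nodeMean_c hW t ω)
    simp only [← h.nodeMean_succ hW] at h2
    set s := nodeMean (x (t + 1) ω) - nodeMean (x t ω)
    set a := nodeMean (∑ l ∈ Finset.range K, gradDev g (y t l ω) (nodeMean (x t ω))) with ha
    set b := nodeMean fun j => g j (nodeMean (x t ω))
    set e := nodeMean (∑ l ∈ Finset.range K, N t l ω)
    have h3 : inner ℝ b s = -η * (inner ℝ b a + K * ‖b‖ ^ 2 + inner ℝ b e) := by
      rw [h2, inner_smul_right, inner_add_right, inner_add_right, inner_smul_right,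
        real_inner_self_eq_norm_sq]
    have h4 : -inner ℝ b a ≤ K / 2 * ‖b‖ ^ 2 + 1 / (2 * K) * ‖a‖ ^ 2 := by
      have e1 : 0 ≤ ‖(K : ℝ) • b + a‖ ^ 2 / (2 * K) := by positivity
      rw [norm_add_sq_real, inner_smul_left, norm_smul, mul_pow, Real.norm_eq_abs, sq_abs] at e1
      have e2 : (K ^ 2 * ‖b‖ ^ 2 + 2 * ((starRingEnd ℝ) (K : ℝ) * inner ℝ b a) + ‖a‖ ^ 2) / (2 * K)
          = K / 2 * ‖b‖ ^ 2 + inner ℝ b a + 1 / (2 * K) * ‖a‖ ^ 2 := by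
        simp only [conj_trivial]; field_simp
      linarith
    have h5 : ‖a‖ ^ 2 ≤
        K * ∑ l ∈ Finset.range K, avgSq (gradDev g (y t l ω) (nodeMean (x t ω))) := by
      have := avgSq_sum_le (Finset.range K) fun l => gradDev g (y t l ω) (nodeMean (x t ω))
      rw [Finset.card_range] at this
      exact (norm_nodeMean_sq_le hn _).trans this
    have h6 : 1 / (2 * (K : ℝ)) * ‖a‖ ^ 2 ≤
        1 / 2 * ∑ l ∈ Finset.range K, avgSq (gradDev g (y t l ω) (nodeMean (x t ω))) := by
      calc _ ≤ 1 / (2 * (K : ℝ)) *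
            (K * ∑ l ∈ Finset.range K, avgSq (gradDev g (y t l ω) (nodeMean (x t ω)))) := by gcongr
        _ = _ := by field_simp
    have h7 : η * -inner ℝ b a ≤ η * (K / 2 * ‖b‖ ^ 2 + 1 / 2 * ∑ l ∈ Finset.range K,
        avgSq (gradDev g (y t l ω) (nodeMean (x t ω)))) := by
      gcongr; linarith
    rw [h3] at h1
    linarith
  have hV := h.memLp_meanGrad hK hg t
  have hE : MemLp (fun ω => nodeMean (∑ l ∈ Finset.range K, N t l ω)) 2 P :=
    (h.memL2_sum_N t (le_refl K)).nodeMean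
  have i0 := h.integrable_objective hK hg hquad hfc hmin t
  have i1 := (h.integrable_meanGrad hK hg t).const_mul (-(η * K / 2))
  have i2 := (h.integrable_sum_gradDev hK hg t le_rfl).const_mul (η / 2)
  have i3 := (MemLp.integrable_inner hV hE).const_mul (-η)
  have i4 := (h.integrable_step hK hg t).const_mul (L / 2)
  have h1 := integral_mono (h.integrable_objective hK hg hquad hfc hmin (t + 1))
    ((((i0.add i1).add i2).add i3).add i4) hpt
  have hcross : ∫ ω, inner ℝ (nodeMean fun j => g j (nodeMean (x t ω)))
      (nodeMean (∑ l ∈ Finset.range K, N t l ω)) ∂P = 0 := by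
    have hi : ∀ i, ∀ l ∈ Finset.range K, Integrable (fun ω =>
        inner ℝ (nodeMean fun j => g j (nodeMean (x t ω))) (N t l ω i)) P := fun i l hl =>
      MemLp.integrable_inner hV (h.memL2_N t l (Finset.mem_range.1 hl) i)
    have e : ∀ ω, inner ℝ (nodeMean fun j => g j (nodeMean (x t ω)))
        (nodeMean (∑ l ∈ Finset.range K, N t l ω)) = 1 / (n : ℝ) * ∑ i, ∑ l ∈ Finset.range K,
          inner ℝ (nodeMean fun j => g j (nodeMean (x t ω))) (N t l ω i) := fun ω => by
      conv_lhs => rw [nodeMean.eq_1 (∑ l ∈ Finset.range K, N t l ω)]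
      simp only [inner_smul_right, inner_sum, Finset.sum_apply]
    simp only [e]
    rw [integral_const_mul, integral_finsetSum _ fun i _ => integrable_finsetSum _ (hi i),
      Finset.sum_eq_zero, mul_zero]
    intro i _
    rw [integral_finsetSum _ (hi i)]
    exact Finset.sum_eq_zero fun l hl => h.centred t l (Finset.mem_range.1 hl) i
  rw [integral_add' (((i0.add i1).add i2).add i3) i4, integral_add' ((i0.add i1).add i2) i3,
    integral_add' (i0.add i1) i2, integral_add' i0 i1, integral_const_mul, integral_const_mul,
    integral_const_mul, integral_const_mul, hcross] at h1
  have h2 := h.sum_gradDev_le hn hK hg hu2 t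
  have h3 := h.step_le hn hK hW hg hu2 t
  set m := driftBound P g x c K L η σ t with hm
  have hΔ : 0 ≤ consensusErr P x t := consensusErr_nonneg t
  have hΓ : 0 ≤ correctionErr P g x c t := correctionErr_nonneg t
  have hG : 0 ≤ gradSq P g x t := gradSq_nonneg t
  have hm0 : 0 ≤ m := by rw [hm, driftBound]; positivity
  change _ ≤ _ + -(η * K / 2) * gradSq P g x t + _ + _ + _ at h1
  have h4 : L / 2 * ∫ ω, ‖nodeMean (x (t + 1) ω) - nodeMean (x t ω)‖ ^ 2 ∂P ≤
      η * K * (3 / 2 * (K * L * η) * (2 * m + 2 * (L ^ 2 * consensusErr P x t) + gradSq P g x t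
        + σ ^ 2 / (K * n))) := by
    calc _ = 1 / (2 * L) *
          (L ^ 2 * ∫ ω, ‖nodeMean (x (t + 1) ω) - nodeMean (x t ω)‖ ^ 2 ∂P) := by field_simp
      _ ≤ 1 / (2 * L) * (3 * (K * L * η) ^ 2 * (2 * m + 2 * (L ^ 2 * consensusErr P x t)
          + gradSq P g x t + σ ^ 2 / (K * n))) := by gcongr
      _ = _ := by field_simp
  have h5 : η / 2 * ∫ ω, ∑ l ∈ Finset.range K, avgSq (gradDev g (y t l ω) (nodeMean (x t ω))) ∂P ≤
      η * K * (m + L ^ 2 * consensusErr P x t) := by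
    calc _ ≤ η / 2 * (K * (2 * (m + L ^ 2 * consensusErr P x t))) := by gcongr
      _ = _ := by ring
  have h6 : 3 / 2 * (K * L * η) * (2 * m + 2 * (L ^ 2 * consensusErr P x t) + gradSq P g x t
        + σ ^ 2 / (K * n)) ≤ (m + L ^ 2 * consensusErr P x t) + 1 / 8 * gradSq P g x t
        + 2 * (K * L * η) * (σ ^ 2 / (K * n)) := by
    have e1 : 3 * (K * L * η) * (m + L ^ 2 * consensusErr P x t) ≤
        1 * (m + L ^ 2 * consensusErr P x t) := by gcongr; linarith
    have e2 : 3 / 2 * (K * L * η) * gradSq P g x t ≤ 1 / 8 * gradSq P g x t := by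
      gcongr; linarith
    have e3 : 3 / 2 * (K * L * η) * (σ ^ 2 / (K * n)) ≤ 2 * (K * L * η) * (σ ^ 2 / (K * n)) := by
      gcongr; norm_num
    linarith
  have h7 := mul_le_mul_of_nonneg_left h6 (show 0 ≤ η * K by positivity)
  linarith

end IsTrackingRun

/-- One step of the Lyapunov function for gradient tracking: `q p²` is the effective stepsize. -/
theorem lyapunov_step {p q δ δ' Γ Γ' G s r τ m φ φ' : ℝ} (hp : 0 < p) (hp1 : p ≤ 1) (hq : 0 < q)
    (hq1 : q ≤ 1 / 1000) (hδ : 0 ≤ δ) (hΓ : 0 ≤ Γ) (hG : 0 ≤ G) (hs : 0 ≤ s)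
    (hm : m = 8 * (q * p ^ 2) ^ 2 * (2 * δ + Γ + G + s))
    (hδ' : δ' ≤ (1 - p / 2) * δ + 9 / p * (q * p ^ 2) ^ 2 * (2 * m + 2 * δ + Γ + s))
    (hΓ' : Γ' ≤ (1 - p / 2) * Γ
      + 6 / p * (17 * m + 17 * δ + 8 * τ + 3 * (q * p ^ 2) ^ 2 * (G + s)))
    (hφ : φ' ≤ φ + (-(3 / 8) * G + 2 * (m + δ) + 2 * (q * p ^ 2) * r)) :
    φ' + 8 / p * δ' + 200 * q ^ 2 * p * Γ' ≤ φ + 8 / p * δ + 200 * q ^ 2 * p * Γ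
      - 1 / 4 * G + (2 * (q * p ^ 2) * r + 100 * q ^ 2 * s + 9600 * q ^ 2 * τ) := by
  have h1 : 8 / p * δ' ≤ 8 / p * δ - 4 * δ + 72 * (q ^ 2 * p ^ 2) * (2 * m + 2 * δ + Γ + s) := by
    calc _ ≤ 8 / p * ((1 - p / 2) * δ + 9 / p * (q * p ^ 2) ^ 2 * (2 * m + 2 * δ + Γ + s)) := by
          gcongr
      _ = _ := by field_simp; ring
  have h2 : 200 * q ^ 2 * p * Γ' ≤ 200 * q ^ 2 * p * Γ - 100 * (q ^ 2 * p ^ 2) * Γ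
      + 1200 * q ^ 2 * (17 * m + 17 * δ + 8 * τ + 3 * (q ^ 2 * p ^ 4) * (G + s)) := by
    calc _ ≤ 200 * q ^ 2 * p * ((1 - p / 2) * Γ
          + 6 / p * (17 * m + 17 * δ + 8 * τ + 3 * (q * p ^ 2) ^ 2 * (G + s))) := by gcongr
      _ = _ := by field_simp; ring
  -- The budget: δ has −4 + 2, Γ has Q p² (−100 + 72), and G has −3/8 against the required −1/4.
  -- Everything else, including what `m` brings in, has to fit into these margins.
  set Q := q ^ 2 with hQ
  have hQ0 : 0 ≤ Q := sq_nonneg q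
  have hQ1 : Q ≤ 1 / 1000000 := by rw [hQ]; nlinarith
  have hP1 : p ^ 2 ≤ 1 := pow_le_one₀ hp.le hp1
  have hP2 : p ^ 4 ≤ p ^ 2 := pow_le_pow_of_le_one hp.le hp1 (by norm_num)
  have hQP : Q * p ^ 2 ≤ Q := mul_le_of_le_one_right hQ0 hP1
  have hQP4 : Q * p ^ 4 ≤ Q * p ^ 2 := by gcongr
  have hQP0 : 0 ≤ Q * p ^ 2 := by positivity
  have hm' : m = 8 * (Q * p ^ 4) * (2 * δ + Γ + G + s) := by rw [hm, hQ]; ring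
  have hm0 : 0 ≤ m := by rw [hm']; positivity
  -- A factor p² must be kept at Γ, since the available decrease of Γ is itself of order Q p².
  have hm1 : m ≤ 8 * Q * (2 * δ + G + s) + 8 * (Q * p ^ 2) * Γ := by
    have : Q * p ^ 4 * (2 * δ + G + s) ≤ Q * (2 * δ + G + s) := by gcongr; linarith
    have : Q * p ^ 4 * Γ ≤ Q * p ^ 2 * Γ := by gcongr
    rw [hm']; linarith
  have em : Q * p ^ 2 * m ≤ 1 / 1000000 * m := by gcongr; linarith
  have em' : Q * m ≤ 1 / 1000000 * m := by gcongr
  have ed : Q * p ^ 2 * δ ≤ 1 / 1000000 * δ := by gcongr; linarith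
  have ed' : Q * δ ≤ 1 / 1000000 * δ := by gcongr
  have es : Q * p ^ 2 * s ≤ Q * s := by gcongr
  have eQG : Q * G ≤ 1 / 1000000 * G := by gcongr
  have hQQ : Q * (Q * p ^ 4) ≤ 1 / 1000000 * Q := by
    rw [mul_comm]; gcongr; linarith
  have eG : Q * (Q * p ^ 4) * G ≤ 1 / 1000000 * Q * G := by gcongr
  have es2 : Q * (Q * p ^ 4) * s ≤ 1 / 1000000 * Q * s := by gcongr
  have e0 : 0 ≤ Q * p ^ 2 * Γ := by positivity
  have e1 : 0 ≤ Q * s := by positivity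
  nlinarith

/-! ### Telescoping the Lyapunov function -/

namespace IsTrackingRun

variable {d n : ℕ} {Ω : Type*} [MeasurableSpace Ω] {P : Measure Ω} [IsProbabilityMeasure P]
  {g : Fin n → Vec d → Vec d} {W : Matrix (Fin n) (Fin n) ℝ} {K : ℕ} {L η σ τ p : ℝ} {x0 : Vec d}
  {x c : ℕ → Ω → Fin n → Vec d} {y N : ℕ → ℕ → Ω → Fin n → Vec d}

theorem average_gradSq_le (h : IsTrackingRun P g W K η σ τ x0 x c y N) (hn : 1 ≤ n)
    (hK : 1 ≤ K) (hL : 0 < L) (hη : 0 < η) (hp : 0 < p) (hp1 : p ≤ 1) (hW : IsMixing d W p)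
    (hg : ∀ i x y, ‖g i x - g i y‖ ≤ L * ‖x - y‖) {q : ℝ} (hq : q ≤ 1 / 1000)
    (hu : K * L * η = q * p ^ 2) {f : Vec d → ℝ} {fmin : ℝ}
    (hquad : ∀ x y, f y ≤ f x + inner ℝ (nodeMean fun j => g j x) (y - x) + L / 2 * ‖y - x‖ ^ 2)
    (hfc : Continuous f) (hmin : ∀ x, fmin ≤ f x) (T : ℕ) :
    1 / ((T : ℝ) + 1) * ∑ t ∈ Finset.range (T + 1), gradSq P g x t ≤
      (4 * (L * (f x0 - fmin)) / (q * p ^ 2) + 800 * q ^ 2 * p * correctionErr P g x c 0) / (T + 1)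
      + (8 * (q * p ^ 2) * (σ ^ 2 / (K * n)) + 400 * q ^ 2 * (σ ^ 2 / K)
        + 38400 * q ^ 2 * τ ^ 2) := by
  have hK0 : (0 : ℝ) < K := by exact_mod_cast hK
  have hq0 : 0 < q := by
    have : 0 < q * p ^ 2 := by rw [← hu]; positivity
    exact pos_of_mul_pos_left this (by positivity)
  have hP1 : p ^ 2 ≤ 1 := pow_le_one₀ hp.le hp1
  have hu1 : K * L * η ≤ 1 / 1000 := by rw [hu]; nlinarith
  have hu2 : 16 * (K * L * η) ^ 2 ≤ 1 := by
    have : 0 < K * L * η := by positivity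
    nlinarith
  -- Dividing by ηK removes the stepsize from the gradient term in the descent inequality.
  set φ : ℕ → ℝ := fun t => (∫ ω, f (nodeMean (x t ω)) ∂P) / (η * K) with hφ
  set V : ℕ → ℝ := fun t => φ t + 8 / p * (L ^ 2 * consensusErr P x t)
    + 200 * q ^ 2 * p * correctionErr P g x c t with hV
  set ν := 2 * (q * p ^ 2) * (σ ^ 2 / (K * n)) + 100 * q ^ 2 * (σ ^ 2 / K)
    + 9600 * q ^ 2 * τ ^ 2 with hν
  have hstep : ∀ t, V (t + 1) ≤ V t - 1 / 4 * gradSq P g x t + ν := fun t => by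
    have hd := h.descent hn hK hL hη hW hg (by linarith) hquad hfc hmin t
    have hcons := h.consensusErr_succ_le hn hK hp hp1 hW hg hu2 t
    have hcorr := h.correctionErr_succ_le hn hK hp hp1 hW hg hu2 t
    rw [hu] at hd hcons hcorr
    refine lyapunov_step hp hp1 hq0 hq (mul_nonneg (sq_nonneg L) (consensusErr_nonneg t))
      (correctionErr_nonneg t) (gradSq_nonneg t) (by positivity) ?_ hcons hcorr ?_
    · rw [driftBound, hu]
    · simp only [hφ]
      rw [div_le_iff₀ (by positivity), add_mul, div_mul_cancel₀ _ (by positivity)]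
      linarith
  have hsum : ∀ T : ℕ, 1 / 4 * ∑ t ∈ Finset.range T, gradSq P g x t ≤ V 0 - V T + T * ν := by
    intro T
    induction T with
    | zero => simp
    | succ T ih =>
      rw [Finset.sum_range_succ]
      push_cast
      linarith [hstep T]
  have hφT : ∀ t, fmin / (η * K) ≤ φ t := fun t => by
    simp only [hφ]
    gcongr
    have := integral_mono (integrable_const fmin) (h.integrable_objective hK hg hquad hfc hmin t)
      fun ω => hmin _
    simpa using this
  have hVT : fmin / (η * K) ≤ V (T + 1) := by
    have h1 : 0 ≤ 8 / p * (L ^ 2 * consensusErr P x (T + 1)) := by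
      have : 0 ≤ consensusErr P x (T + 1) := consensusErr_nonneg _
      positivity
    have h2 : 0 ≤ 200 * q ^ 2 * p * correctionErr P g x c (T + 1) := by
      have : 0 ≤ correctionErr P g x c (T + 1) := correctionErr_nonneg _
      positivity
    simp only [hV]
    linarith [hφT (T + 1)]
  have hV0 : V 0 = f x0 / (η * K) + 200 * q ^ 2 * p * correctionErr P g x c 0 := by
    have h1 : consensusErr P x 0 = 0 := by
      simp only [consensusErr, h.x_zero, nodeMean_const hn, sub_self]
      simp [avgSq]
    have h2 : φ 0 = f x0 / (η * K) := by
      simp [hφ, h.x_zero, nodeMean_const hn]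
    simp only [hV]
    rw [h1, h2]; ring
  have hfin := hsum (T + 1)
  push_cast at hfin
  have hT : (0 : ℝ) < T + 1 := by positivity
  have e : (f x0 - fmin) / (η * K) = L * (f x0 - fmin) / (q * p ^ 2) := by
    rw [← hu]; field_simp
  have e' : (f x0 - fmin) / (η * K) = f x0 / (η * K) - fmin / (η * K) := sub_div _ _ _
  rw [one_div_mul_eq_div, div_add' _ _ _ hT.ne']
  gcongr
  have e4 : 4 * (L * (f x0 - fmin)) / (q * p ^ 2) = 4 * ((f x0 - fmin) / (η * K)) := by
    rw [e]; ring
  rw [e4, e']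
  linarith

end IsTrackingRun

/-! ### Gradient oracles -/

section Oracle

variable {d n : ℕ} {Ξ : Type*} [MeasurableSpace Ξ]

/-- `G i x ξ`, with `ξ ∼ Dᵢ`, is an unbiased estimate of `gᵢ(x)` of variance at most `σ²`. -/
structure IsOracle (D : Fin n → Measure Ξ) (g : Fin n → Vec d → Vec d)
    (G : Fin n → Vec d → Ξ → Vec d) (σ : ℝ) : Prop where
  measurable : ∀ i, Measurable fun q : Vec d × Ξ => G i q.1 q.2
  integrable_sq : ∀ i x, Integrable (fun ξ => ‖G i x ξ - g i x‖ ^ 2) (D i)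
  variance_le : ∀ i x, ∫ ξ, ‖G i x ξ - g i x‖ ^ 2 ∂(D i) ≤ σ ^ 2
  unbiased : ∀ i x, ∫ ξ, G i x ξ ∂(D i) = g i x

theorem IsOracle.mono {D : Fin n → Measure Ξ} {g : Fin n → Vec d → Vec d}
    {G : Fin n → Vec d → Ξ → Vec d} {τ σ : ℝ} (h : IsOracle D g G τ) (hτ : τ ^ 2 ≤ σ ^ 2) :
    IsOracle D g G σ :=
  ⟨h.measurable, h.integrable_sq, fun i x => (h.variance_le i x).trans hτ, h.unbiased⟩

theorem isOracle_exact {D : Fin n → Measure Ξ} (hD : ∀ i, IsProbabilityMeasure (D i))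
    {g : Fin n → Vec d → Vec d} (hg : ∀ i, Measurable (g i)) :
    IsOracle D g (fun i x _ => g i x) 0 where
  measurable i := (hg i).comp measurable_fst
  integrable_sq i x := by simp
  variance_le i x := by simp
  unbiased i x := by have := hD i; simp

variable {D : Fin n → Measure Ξ} {g : Fin n → Vec d → Vec d} {G : Fin n → Vec d → Ξ → Vec d}
  {σ : ℝ}

theorem IsOracle.measurable_noise (h : IsOracle D g G σ) (hgm : ∀ i, Measurable (g i))
    (i : Fin n) : Measurable fun q : Vec d × Ξ => G i q.1 q.2 - g i q.1 :=
  (h.measurable i).sub ((hgm i).comp measurable_fst)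

theorem IsOracle.integral_noise (h : IsOracle D g G σ) (hgm : ∀ i, Measurable (g i))
    (hD : ∀ i, IsProbabilityMeasure (D i)) (i : Fin n) (x : Vec d) :
    Integrable (fun ξ => G i x ξ - g i x) (D i) ∧ ∫ ξ, (G i x ξ - g i x) ∂(D i) = 0 := by
  have := hD i
  have hm : Measurable fun ξ => G i x ξ - g i x :=
    (h.measurable_noise hgm i).comp measurable_prodMk_left
  have h2 : MemLp (fun ξ => G i x ξ - g i x) 2 (D i) :=
    (memLp_two_iff_integrable_sq_norm hm.aestronglyMeasurable).2 (h.integrable_sq i x)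
  have h1 := h2.integrable one_le_two
  refine ⟨h1, ?_⟩
  have h3 : Integrable (fun ξ => G i x ξ) (D i) := by
    refine (h1.add (integrable_const (g i x))).congr (Filter.Eventually.of_forall fun ξ => ?_)
    simp
  rw [integral_sub h3 (integrable_const _), h.unbiased]
  simp

variable {Ω : Type*} [MeasurableSpace Ω] {P : Measure Ω} [IsProbabilityMeasure P]

/-- Independence turns the joint law into a product; Fubini then integrates over the sample with the
query point frozen, where the variance bound is uniform. -/
theorem IsOracle.noise_sq (h : IsOracle D g G σ) (hgm : ∀ i, Measurable (g i))
    (hD : ∀ i, IsProbabilityMeasure (D i)) {i : Fin n} {X : Ω → Vec d} {Z : Ω → Ξ}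
    (hX : Measurable X) (hZ : Measurable Z) (hlaw : P.map Z = D i) (hind : IndepFun X Z P) :
    MemLp (fun ω => G i (X ω) (Z ω) - g i (X ω)) 2 P ∧
      ∫ ω, ‖G i (X ω) (Z ω) - g i (X ω)‖ ^ 2 ∂P ≤ σ ^ 2 := by
  have := hD i
  have : IsProbabilityMeasure (P.map X) := Measure.isProbabilityMeasure_map hX.aemeasurable
  have hmap : P.map (fun ω => (X ω, Z ω)) = (P.map X).prod (D i) := by
    rw [← hlaw]
    exact (indepFun_iff_map_prod_eq_prod_map_map hX.aemeasurable hZ.aemeasurable).1 hind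
  have hXZ : Measurable fun ω => (X ω, Z ω) := hX.prodMk hZ
  have hm := h.measurable_noise hgm i
  have hsq : StronglyMeasurable fun q : Vec d × Ξ => ‖G i q.1 q.2 - g i q.1‖ ^ 2 :=
    (hm.norm.pow_const 2).stronglyMeasurable
  have hI : Integrable (fun q : Vec d × Ξ => ‖G i q.1 q.2 - g i q.1‖ ^ 2)
      ((P.map X).prod (D i)) := by
    rw [integrable_prod_iff hsq.aestronglyMeasurable]
    refine ⟨Filter.Eventually.of_forall fun x => h.integrable_sq i x, ?_⟩
    simp only [norm_pow, norm_norm]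
    refine Integrable.of_bound hsq.integral_prod_right'.aestronglyMeasurable (σ ^ 2)
      (Filter.Eventually.of_forall fun x => ?_)
    rw [Real.norm_eq_abs, abs_of_nonneg (integral_nonneg fun _ => sq_nonneg _)]
    exact h.variance_le i x
  constructor
  · rw [← hmap] at hI
    exact (memLp_two_iff_integrable_sq_norm (hm.comp hXZ).aestronglyMeasurable).2
      (hI.comp_measurable hXZ)
  · have e : ∫ ω, ‖G i (X ω) (Z ω) - g i (X ω)‖ ^ 2 ∂P =
        ∫ q, ‖G i q.1 q.2 - g i q.1‖ ^ 2 ∂((P.map X).prod (D i)) := by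
      rw [← hmap, integral_map hXZ.aemeasurable hsq.aestronglyMeasurable]
    rw [e, integral_prod _ hI]
    calc _ ≤ ∫ _x, σ ^ 2 ∂(P.map X) :=
          integral_mono hI.integral_prod_left (integrable_const _) fun x => h.variance_le i x
      _ = _ := by simp

/-- A substitute for conditional expectation: given everything except the fresh sample, the noise
integrates to zero. -/
theorem IsOracle.inner_noise (h : IsOracle D g G σ) (hgm : ∀ i, Measurable (g i))
    (hD : ∀ i, IsProbabilityMeasure (D i)) {i : Fin n} {V X : Ω → Vec d} {Z : Ω → Ξ}
    (hV : Measurable V) (hX : Measurable X) (hZ : Measurable Z) (hlaw : P.map Z = D i)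
    (hind : IndepFun (fun ω => (V ω, X ω)) Z P) :
    ∫ ω, inner ℝ (V ω) (G i (X ω) (Z ω) - g i (X ω)) ∂P = 0 := by
  have := hD i
  have hVX : Measurable fun ω => (V ω, X ω) := hV.prodMk hX
  have : IsProbabilityMeasure (P.map fun ω => (V ω, X ω)) :=
    Measure.isProbabilityMeasure_map hVX.aemeasurable
  have hmap : P.map (fun ω => ((V ω, X ω), Z ω)) = (P.map fun ω => (V ω, X ω)).prod (D i) := by
    rw [← hlaw]
    exact (indepFun_iff_map_prod_eq_prod_map_map hVX.aemeasurable hZ.aemeasurable).1 hind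
  have hm : Measurable fun q : (Vec d × Vec d) × Ξ =>
      (inner ℝ q.1.1 (G i q.1.2 q.2 - g i q.1.2) : ℝ) :=
    (measurable_fst.comp measurable_fst).inner ((h.measurable_noise hgm i).comp
      ((measurable_snd.comp measurable_fst).prodMk measurable_snd))
  have e : ∫ ω, inner ℝ (V ω) (G i (X ω) (Z ω) - g i (X ω)) ∂P =
      ∫ q, inner ℝ q.1.1 (G i q.1.2 q.2 - g i q.1.2)
        ∂((P.map fun ω => (V ω, X ω)).prod (D i)) := by
    rw [← hmap, integral_map (hVX.prodMk hZ).aemeasurable hm.aestronglyMeasurable]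
  rw [e]
  -- No integrability of `V` is assumed: a non-integrable function has integral 0 by convention.
  by_cases hI : Integrable (fun q : (Vec d × Vec d) × Ξ =>
      (inner ℝ q.1.1 (G i q.1.2 q.2 - g i q.1.2) : ℝ)) ((P.map fun ω => (V ω, X ω)).prod (D i))
  · rw [integral_prod _ hI]
    refine integral_eq_zero_of_ae (Filter.Eventually.of_forall fun q => ?_)
    have h1 := h.integral_noise hgm hD i q.2
    simp only [Pi.zero_apply]
    rw [integral_inner h1.1, h1.2, inner_zero_right]
  · exact integral_undef hI

end Oracle

/-! ### Gradient tracking along a sample path -/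

section Track

variable {d n : ℕ} {Ξ : Type*}

/-- Local steps with the gradient estimate `G k` at step `k` and fixed corrections `C`. -/
def trackPath (G : ℕ → Fin n → Vec d → Ξ → Vec d) (η : ℝ) (s : ℕ → Fin n → Ξ)
    (X C : Fin n → Vec d) : ℕ → Fin n → Vec d
  | 0 => X
  | k + 1 => fun i => trackPath G η s X C k i
      - η • (G k i (trackPath G η s X C k i) (s k i) + C i)

/-- The gradient estimates of the last local step. -/
def lastGrad (G : ℕ → Fin n → Vec d → Ξ → Vec d) (η : ℝ) (K : ℕ) (s : ℕ → Fin n → Ξ)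
    (X C : Fin n → Vec d) : Fin n → Vec d :=
  fun i => G (K - 1) i (trackPath G η s X C (K - 1) i) (s (K - 1) i)

/-- Models and corrections of gradient tracking with `K` local steps per round. -/
def track (G : ℕ → Fin n → Vec d → Ξ → Vec d) (W : Matrix (Fin n) (Fin n) ℝ) (K : ℕ) (η : ℝ)
    (x0 : Vec d) (c0 : Fin n → Vec d) (s : ℕ → ℕ → Fin n → Ξ) :
    ℕ → (Fin n → Vec d) × (Fin n → Vec d)
  | 0 => (fun _ => x0, c0)
  | t + 1 =>
    let S := track G W K η x0 c0 s t
    (mix W (trackPath G η (s t) S.1 S.2 K),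
      mix W S.2 + mix W (lastGrad G η K (s t) S.1 S.2) - lastGrad G η K (s t) S.1 S.2)

variable [MeasurableSpace Ξ] {Ω : Type*} {m : MeasurableSpace Ω}
  {G : ℕ → Fin n → Vec d → Ξ → Vec d} {W : Matrix (Fin n) (Fin n) ℝ} {K : ℕ} {η : ℝ} {x0 : Vec d}

theorem measurable_mix {Y : Ω → Fin n → Vec d} (hY : ∀ i, Measurable[m] fun ω => Y ω i)
    (i : Fin n) : Measurable[m] fun ω => mix W (Y ω) i :=
  Finset.measurable_sum _ fun j _ => (hY j).const_smul (W i j)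

theorem measurable_nodeMean {Y : Ω → Fin n → Vec d} (hY : ∀ i, Measurable[m] fun ω => Y ω i) :
    Measurable[m] fun ω => nodeMean (Y ω) :=
  (Finset.measurable_sum _ fun i _ => hY i).const_smul (1 / (n : ℝ))

theorem measurable_trackPath (hG : ∀ k < K, ∀ i, Measurable fun q : Vec d × Ξ => G k i q.1 q.2)
    {s : ℕ → Fin n → Ω → Ξ} {X C : Ω → Fin n → Vec d} (hX : ∀ i, Measurable[m] fun ω => X ω i)
    {k : ℕ} (hk : k ≤ K) (hC : 0 < k → ∀ i, Measurable[m] fun ω => C ω i)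
    (hs : ∀ l < k, ∀ i, Measurable[m] (s l i)) (i : Fin n) :
    Measurable[m] fun ω => trackPath G η (fun l i => s l i ω) (X ω) (C ω) k i := by
  induction k generalizing i with
  | zero => exact hX i
  | succ k ih =>
    have hy := ih (by omega) (fun _ => hC (by omega)) fun l hl => hs l (by omega)
    simp only [trackPath]
    exact (hy i).sub ((((hG k (by omega) i).comp ((hy i).prodMk (hs k (by omega) i))).add
      (hC (by omega) i)).const_smul η)

theorem measurable_track (hG : ∀ k < K, ∀ i, Measurable fun q : Vec d × Ξ => G k i q.1 q.2)
    (hK : 1 ≤ K) {ξ : ℕ → ℕ → Fin n → Ω → Ξ} {c0 : Ω → Fin n → Vec d}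
    (hc0 : ∀ i, Measurable[m] fun ω => c0 ω i) {t : ℕ}
    (hs : ∀ t' < t, ∀ k < K, ∀ i, Measurable[m] (ξ t' k i)) :
    (∀ i, Measurable[m] fun ω => (track G W K η x0 (c0 ω) (fun t k i => ξ t k i ω) t).1 i) ∧
    ∀ i, Measurable[m] fun ω => (track G W K η x0 (c0 ω) (fun t k i => ξ t k i ω) t).2 i := by
  induction t with
  | zero => exact ⟨fun i => measurable_const, hc0⟩
  | succ t ih =>
    obtain ⟨h1, h2⟩ := ih fun t' ht' => hs t' (by omega)
    have hy := fun k hk => measurable_trackPath (η := η) hG h1 (k := k) hk (fun _ => h2)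
      (s := ξ t) fun l hl => hs t (by omega) l (by omega)
    have hh : ∀ i, Measurable[m] fun ω => lastGrad G η K (fun k i => ξ t k i ω)
        (track G W K η x0 (c0 ω) (fun t k i => ξ t k i ω) t).1
        (track G W K η x0 (c0 ω) (fun t k i => ξ t k i ω) t).2 i := fun i =>
      (hG (K - 1) (by omega) i).comp ((hy (K - 1) (by omega) i).prodMk
        (hs t (by omega) (K - 1) (by omega) i))
    exact ⟨fun i => measurable_mix (hy K le_rfl) i,
      fun i => ((measurable_mix h2 i).add (measurable_mix hh i)).sub (hh i)⟩

/-- The local models before step `k` of round `t` only depend on the earlier samples. -/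
theorem measurable_trackPath_track
    (hG : ∀ k < K, ∀ i, Measurable fun q : Vec d × Ξ => G k i q.1 q.2) (hK : 1 ≤ K)
    {ξ : ℕ → ℕ → Fin n → Ω → Ξ} {c0 : Ω → Fin n → Vec d}
    (hc0 : (∀ i, Measurable[m] (ξ 0 0 i)) → ∀ i, Measurable[m] fun ω => c0 ω i) {t k : ℕ}
    (hk : k ≤ K) (hs : ∀ t' < t, ∀ k < K, ∀ i, Measurable[m] (ξ t' k i))
    (hs' : ∀ l < k, ∀ i, Measurable[m] (ξ t l i)) (i : Fin n) :
    Measurable[m] fun ω => trackPath G η (fun l i => ξ t l i ω)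
      (track G W K η x0 (c0 ω) (fun t k i => ξ t k i ω) t).1
      (track G W K η x0 (c0 ω) (fun t k i => ξ t k i ω) t).2 k i := by
  -- Round 0 is special: the initial corrections may depend on the samples `ξ 0 0`, which are reused
  -- at its first step. The model at that step is the constant `x0`, so corrections are needed only
  -- for k > 0, when `ξ 0 0` already belongs to the past.
  rcases Nat.eq_zero_or_pos t with rfl | ht
  · refine measurable_trackPath hG (fun i => measurable_const) hk (fun hk0 => ?_) hs' i
    exact hc0 (hs' 0 hk0)
  · have h0 := hc0 (hs 0 ht 0 (by omega))
    obtain ⟨h1, h2⟩ := measurable_track (W := W) (η := η) (x0 := x0) hG hK h0 hs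
    exact measurable_trackPath hG h1 hk (fun _ => h2) hs' i

end Track

/-! ### The run of gradient tracking with sampled gradients -/

section Sampled

variable {d n : ℕ} {Ξ Ω : Type*} [MeasurableSpace Ξ] {D : Fin n → Measure Ξ} {g : Fin n → Vec d → Vec d}
  {G : ℕ → Fin n → Vec d → Ξ → Vec d} {W : Matrix (Fin n) (Fin n) ℝ} {K : ℕ} {η σ τ : ℝ}
  {x0 : Vec d} {ξ : ℕ → ℕ → Fin n → Ω → Ξ}

/-- The σ-algebra generated by all samples but `q`. -/
abbrev otherSamples (K : ℕ) (ξ : ℕ → ℕ → Fin n → Ω → Ξ) (q : ℕ × Fin K × Fin n) :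
    MeasurableSpace Ω :=
  ⨆ r ∈ ({q}ᶜ : Set (ℕ × Fin K × Fin n)),
    MeasurableSpace.comap (ξ r.1 r.2.1 r.2.2) inferInstance

theorem measurable_otherSamples (q : ℕ × Fin K × Fin n) {t k : ℕ} (hk : k < K) {i : Fin n}
    (hne : (t, ⟨k, hk⟩, i) ≠ q) : Measurable[otherSamples K ξ q] (ξ t k i) := by
  rw [measurable_iff_comap_le]
  exact le_iSup₂_of_le (f := fun (r : ℕ × Fin K × Fin n) (_ : r ∈ ({q}ᶜ : Set _)) =>
    MeasurableSpace.comap (ξ r.1 r.2.1 r.2.2) inferInstance) (t, ⟨k, hk⟩, i) hne le_rfl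

variable [MeasurableSpace Ω] {P : Measure Ω}

theorem otherSamples_le (hξ : IsSampling P D K ξ) (q : ℕ × Fin K × Fin n) :
    otherSamples K ξ q ≤ ‹MeasurableSpace Ω› :=
  iSup₂_le fun r _ => (hξ.measurable r.1 r.2.1 r.2.1.2 r.2.2).comap_le

/-- Excluding a single sample, rather than using the filtration of the past, treats earlier steps
and other nodes at the same step alike. -/
theorem indepFun_otherSamples (hξ : IsSampling P D K ξ) {β : Type*} [MeasurableSpace β]
    (q : ℕ × Fin K × Fin n) {V : Ω → β} (hV : Measurable[otherSamples K ξ q] V) :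
    IndepFun V (ξ q.1 q.2.1 q.2.2) P := by
  rw [IndepFun_iff_Indep]
  have h1 := indep_iSup_of_disjoint
    (fun r : ℕ × Fin K × Fin n => (hξ.measurable r.1 r.2.1 r.2.1.2 r.2.2).comap_le)
    ((iIndepFun_iff_iIndep _ _ _).1 hξ.indep) (disjoint_compl_left (a := ({q} : Set _)))
  refine indep_of_indep_of_le_left (indep_of_indep_of_le_right h1 ?_) hV.comap_le
  exact le_iSup₂_of_le (f := fun (r : ℕ × Fin K × Fin n) (_ : r ∈ ({q} : Set _)) =>
    MeasurableSpace.comap (ξ r.1 r.2.1 r.2.2) inferInstance) q rfl le_rfl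

variable [IsProbabilityMeasure P]

/-- A query point, and any noise term of another node or an earlier step, is measurable with respect
to the samples other than the current one. All moment conditions follow by integrating that sample
out. -/
theorem isTrackingRun_track (hK : 1 ≤ K) (hgm : ∀ i, Measurable (g i))
    (hD : ∀ i, IsProbabilityMeasure (D i)) (hG : ∀ k < K, IsOracle D g (G k) σ)
    (hGlast : IsOracle D g (G (K - 1)) τ) (hξ : IsSampling P D K ξ) {c0 : Ω → Fin n → Vec d}
    (hc0 : ∀ m : MeasurableSpace Ω, (∀ i, Measurable[m] (ξ 0 0 i)) →
      ∀ i, Measurable[m] fun ω => c0 ω i)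
    (hc0L : MemL2 P c0) (hc0mean : ∀ ω, nodeMean (c0 ω) = 0) :
    let S := fun t ω => track G W K η x0 (c0 ω) (fun t k i => ξ t k i ω) t
    let y := fun t k ω => trackPath G η (fun l i => ξ t l i ω) (S t ω).1 (S t ω).2 k
    IsTrackingRun P g W K η σ τ x0 (fun t ω => (S t ω).1) (fun t ω => (S t ω).2) y
      fun t k ω i => G k i (y t k ω i) (ξ t k i ω) - g i (y t k ω i) := by
  intro S y
  have hGm : ∀ k < K, ∀ i, Measurable fun q : Vec d × Ξ => G k i q.1 q.2 :=
    fun k hk => (hG k hk).measurable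
  have hyo : ∀ t k (hk : k < K) i j l, l ≤ k →
      Measurable[otherSamples K ξ (t, ⟨k, hk⟩, i)] fun ω => y t l ω j :=
    fun t k hk i j l hl => measurable_trackPath_track hGm hK (hc0 _) (by omega)
      (fun t' ht' k' hk' i' => measurable_otherSamples _ hk' (by simp; omega))
      (fun l' hl' i' => measurable_otherSamples _ (by omega) (by simp; omega)) j
  have hym : ∀ t, ∀ k < K, ∀ i, Measurable fun ω => y t k ω i := fun t k hk i =>
    (hyo t k hk i i k le_rfl).mono (otherSamples_le hξ _) le_rfl
  have hNo : ∀ t k (hk : k < K) i l j, l ≤ k → (k, i) ≠ (l, j) →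
      Measurable[otherSamples K ξ (t, ⟨k, hk⟩, i)] fun ω =>
        G l j (y t l ω j) (ξ t l j ω) - g j (y t l ω j) := fun t k hk i l j hl hne =>
    ((hG l (by omega)).measurable_noise hgm j).comp ((hyo t k hk i j l hl).prodMk
      (measurable_otherSamples _ (by omega) (by
        intro e
        simp only [Prod.mk.injEq, Fin.mk.injEq, true_and] at e
        exact hne (by rw [e.1, e.2]))))
  have hsq : ∀ t, ∀ k < K, ∀ i, ∀ σ', IsOracle D g (G k) σ' →
      MemLp (fun ω => G k i (y t k ω i) (ξ t k i ω) - g i (y t k ω i)) 2 P ∧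
      ∫ ω, ‖G k i (y t k ω i) (ξ t k i ω) - g i (y t k ω i)‖ ^ 2 ∂P ≤ σ' ^ 2 :=
    fun t k hk i σ' ho => ho.noise_sq hgm hD (hym t k hk i) (hξ.measurable t k hk i)
      (hξ.law t k hk i)
      (indepFun_otherSamples hξ (t, ⟨k, hk⟩, i) (hyo t k hk i i k le_rfl))
  have hcorr : ∀ t k (hk : k < K) i (V : Ω → Vec d),
      Measurable[otherSamples K ξ (t, ⟨k, hk⟩, i)] V →
      ∫ ω, inner ℝ (V ω) (G k i (y t k ω i) (ξ t k i ω) - g i (y t k ω i)) ∂P = 0 :=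
    fun t k hk i V hV => (hG k hk).inner_noise hgm hD (hV.mono (otherSamples_le hξ _) le_rfl)
      (hym t k hk i) (hξ.measurable t k hk i) (hξ.law t k hk i)
      (indepFun_otherSamples hξ (t, ⟨k, hk⟩, i) (hV.prodMk (hyo t k hk i i k le_rfl)))
  have hun : ∀ t, ∀ k < K, ∀ l ≤ k, ∀ i j, (k, i) ≠ (l, j) →
      ∫ ω, inner ℝ (G l j (y t l ω j) (ξ t l j ω) - g j (y t l ω j))
        (G k i (y t k ω i) (ξ t k i ω) - g i (y t k ω i)) ∂P = 0 :=
    fun t k hk l hl i j hne => hcorr t k hk i _ (hNo t k hk i l j hl hne)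
  exact
  { path := fun t ω => ⟨rfl, fun k _ i => by simp [y, trackPath]⟩
    x_zero := fun ω => rfl
    x_succ := fun t ω => rfl
    c_zero := hc0mean
    c_succ := fun t ω => by
      simp only [add_sub_cancel]
      rfl
    memL2_c := hc0L
    memL2_N := fun t k hk i => (hsq t k hk i σ (hG k hk)).1
    variance_le := fun t k hk i => (hsq t k hk i σ (hG k hk)).2
    variance_last_le := fun t i => (hsq t (K - 1) (by omega) i τ hGlast).2
    uncorrelated := fun t k hk l hl i j hne => by
      -- The noise of the later step is the one averaged out, so the two steps are ordered first.
      rcases le_total l k with hlk | hkl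
      · simp only [real_inner_comm (G l j _ _ - _)]
        exact hun t k hk l hlk i j hne
      · exact hun t l hl k hkl j i hne.symm
    centred := fun t k hk i => by
      refine hcorr t k hk i _ ?_
      have hx : ∀ j, Measurable[otherSamples K ξ (t, ⟨k, hk⟩, i)] fun ω => (S t ω).1 j :=
        fun j => hyo t k hk i j 0 (Nat.zero_le k)
      exact measurable_nodeMean (Y := fun ω j => g j (nodeMean (S t ω).1)) fun j =>
        (hgm j).comp (measurable_nodeMean hx) }

end Sampled

/-! ### Both algorithms as gradient tracking -/

section Algorithms

variable {d n : ℕ} {Ξ : Type*}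

theorem mix_sub_one_smul (W : Matrix (Fin n) (Fin n) ℝ) (X Y : Fin n → Vec d) :
    mix W (fun j => X j - (1 : ℝ) • (X j - Y j)) = mix W Y := by
  simp

/-- A local tracking update exchanges the old stochastic gradient for the new one, so the difference
between tracking variable and current stochastic gradient is conserved. -/
theorem pgtLocal_eq (G : Fin n → Vec d → Ξ → Vec d) (η : ℝ) (s : ℕ → Fin n → Ξ)
    (X C : Fin n → Vec d) (k : ℕ) :
    pgtLocal G η s (X, fun i => C i + G i (X i) (s 0 i)) k =
      (trackPath (fun _ => G) η s X C k,
        fun i => C i + G i (trackPath (fun _ => G) η s X C k i) (s k i)) := by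
  induction k with
  | zero => rfl
  | succ k ih =>
    have h1 : ∀ i, trackPath (fun _ => G) η s X C k i
        - η • (C i + G i (trackPath (fun _ => G) η s X C k i) (s k i)) =
        trackPath (fun _ => G) η s X C (k + 1) i := fun i => by
      rw [trackPath, add_comm]
    simp only [pgtLocal, ih, h1]
    refine Prod.ext rfl ?_
    ext1 i
    simp only
    abel

theorem pgt_eq (G : Fin n → Vec d → Ξ → Vec d) (W : Matrix (Fin n) (Fin n) ℝ) {K : ℕ}
    (hK : 1 ≤ K) (η : ℝ) (x0 : Vec d) (s : ℕ → ℕ → Fin n → Ξ) (t : ℕ) :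
    let c0 : Fin n → Vec d := fun i => -G i x0 (s 0 0 i) + nodeMean fun j => G j x0 (s 0 0 j)
    let S := track (fun _ => G) W K η x0 c0 s t
    pgt G W K 1 η x0 s t = (S.1, fun i => S.2 i + G i (S.1 i) (s t 0 i)) := by
  intro c0 S
  induction t with
  | zero =>
    refine Prod.ext rfl ?_
    ext1 i
    simp only [pgt, S, track, c0]
    abel
  | succ t ih =>
    obtain ⟨k, rfl⟩ : ∃ k, K = k + 1 := ⟨K - 1, by omega⟩
    set S' := track (fun _ => G) W (k + 1) η x0 c0 s t with hS'
    have h1 : (fun i => trackPath (fun _ => G) η (s t) S'.1 S'.2 k i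
        - η • (S'.2 i + G i (trackPath (fun _ => G) η (s t) S'.1 S'.2 k i) (s t k i))) =
        trackPath (fun _ => G) η (s t) S'.1 S'.2 (k + 1) := by
      ext1 i
      rw [trackPath, add_comm]
    have h2 : pgtLocal G η (s t) (pgt G W (k + 1) 1 η x0 s t) k =
        (trackPath (fun _ => G) η (s t) S'.1 S'.2 k,
          fun i => S'.2 i + G i (trackPath (fun _ => G) η (s t) S'.1 S'.2 k i) (s t k i)) := by
      rw [ih]; exact pgtLocal_eq G η (s t) S'.1 S'.2 k
    have h3 : (pgt G W (k + 1) 1 η x0 s t).1 = S'.1 := by rw [ih]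
    have h4 : (fun i => S'.2 i + G i (trackPath (fun _ => G) η (s t) S'.1 S'.2 k i) (s t k i)) =
        S'.2 + lastGrad (fun _ => G) η (k + 1) (s t) S'.1 S'.2 := rfl
    have h5 : S.1 = mix W (trackPath (fun _ => G) η (s t) S'.1 S'.2 (k + 1)) := rfl
    have h6 : S.2 = mix W S'.2 + mix W (lastGrad (fun _ => G) η (k + 1) (s t) S'.1 S'.2)
      - lastGrad (fun _ => G) η (k + 1) (s t) S'.1 S'.2 := rfl
    simp only [pgt, pgtRound, Nat.add_sub_cancel, h2, h1, h3, mix_sub_one_smul]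
    rw [← h5]
    refine Prod.ext rfl ?_
    ext1 i
    simp only [h4, mix_add, h6, Pi.add_apply, Pi.sub_apply]
    simp only [lastGrad, Nat.add_sub_cancel]
    abel

/-- Stochastic gradients at all local steps but the last one, full gradients at that one. -/
def fullLast (G : Fin n → Vec d → Ξ → Vec d) (g : Fin n → Vec d → Vec d) (K k : ℕ) :
    Fin n → Vec d → Ξ → Vec d :=
  if k + 1 < K then G else fun i x _ => g i x

theorem fpgtLocal_eq (G : Fin n → Vec d → Ξ → Vec d) (g : Fin n → Vec d → Vec d) (η : ℝ)
    (s : ℕ → Fin n → Ξ) (X C : Fin n → Vec d) {K k : ℕ} (hk : k + 1 ≤ K) :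
    fpgtLocal G η s X C k = trackPath (fullLast G g K) η s X C k := by
  induction k with
  | zero => rfl
  | succ k ih =>
    -- Only steps before the last one, k = K − 1, are replaced here.
    have h : fullLast G g K k = G := if_pos (by omega)
    ext1 i
    simp only [fpgtLocal, trackPath, ih (by omega), h]

theorem fpgt_eq (G : Fin n → Vec d → Ξ → Vec d) (g : Fin n → Vec d → Vec d)
    (W : Matrix (Fin n) (Fin n) ℝ) {K : ℕ} (hK : 1 ≤ K) (η : ℝ) (x0 : Vec d) (a : Fin n → Vec d)
    (s : ℕ → ℕ → Fin n → Ξ) (t : ℕ) :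
    fpgt G g W K 1 η x0 a s t =
      track (fullLast G g K) W K η x0 (fun i => -a i + nodeMean a) s t := by
  induction t with
  | zero => rfl
  | succ t ih =>
    obtain ⟨k, rfl⟩ : ∃ k, K = k + 1 := ⟨K - 1, by omega⟩
    have h : fullLast G g (k + 1) k = fun i x (_ : Ξ) => g i x := if_neg (by omega)
    have hl : ∀ s X C, lastGrad (fullLast G g (k + 1)) η (k + 1) s X C =
        fun i => g i (trackPath (fullLast G g (k + 1)) η s X C k i) := fun s X C => by
      ext1 i
      simp only [lastGrad, Nat.add_sub_cancel, h]
    simp only [fpgt, fpgtRound, track, ih, hl, Nat.add_sub_cancel, fpgtLocal_eq G g η _ _ _ le_rfl,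
      mix_sub_one_smul]
    refine Prod.ext ?_ rfl
    simp only [trackPath, h]

end Algorithms

/-! ### The objective -/

section Objective

variable {d n : ℕ} {Ξ : Type*} [MeasurableSpace Ξ] {F : Fin n → Vec d → Ξ → ℝ}
  {D : Fin n → Measure Ξ} {L : ℝ}

theorem hasGradientAt_globalObj (hF : IsSmooth F D L) (x : Vec d) :
    HasGradientAt (globalObj F D) (nodeMean fun j => fullGrad F D j x) x := by
  have h1 : ∀ i, HasFDerivAt (localObj F D i) (InnerProductSpace.toDual ℝ (Vec d)
      (fullGrad F D i x)) x := fun i => ((hF i).1 x).hasGradientAt.hasFDerivAt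
  have h2 := (HasFDerivAt.fun_sum fun i (_ : i ∈ Finset.univ) => h1 i).const_mul (1 / (n : ℝ))
  rw [hasGradientAt_iff_hasFDerivAt]
  refine h2.congr_fderiv ?_
  simp [nodeMean, map_sum]

theorem norm_nodeMean_fullGrad_sub_le (hn : 1 ≤ n) (hL : 0 ≤ L) (hF : IsSmooth F D L)
    (x y : Vec d) :
    ‖(nodeMean fun j => fullGrad F D j x) - nodeMean fun j => fullGrad F D j y‖ ≤ L * ‖x - y‖ := by
  refine le_of_sq_le_sq ?_ (by positivity)
  have h1 := norm_nodeMean_sq_le hn ((fun j => fullGrad F D j x) - fun j => fullGrad F D j y)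
  rw [nodeMean_sub] at h1
  refine h1.trans ?_
  rw [mul_pow, ← avgSq_const (n := n) hn (x - y)]
  refine avgSq_le_of_le fun i => ?_
  rw [← mul_pow]
  exact pow_le_pow_left₀ (norm_nonneg _) ((hF i).2 x y) 2

theorem measurable_fullGrad (hF : IsSmooth F D L) (i : Fin n) : Measurable (fullGrad F D i) :=
  (LipschitzWith.of_dist_le_mul (K := L.toNNReal) fun x y => by
    rw [dist_eq_norm, dist_eq_norm]
    exact ((hF i).2 x y).trans (by gcongr; exact Real.le_coe_toNNReal L)).continuous.measurable

theorem isOracle_stochGrad {σ : ℝ} (hO : IsStochasticObjective F D)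
    (hV : HasBoundedVariance F D σ) : IsOracle D (fullGrad F D) (stochGrad F) σ :=
  ⟨hO.measurable_grad, fun i x => (hV i x).1, fun i x => (hV i x).2, hO.unbiased⟩

end Objective

/-! ### Convergence rates -/

section Rates

variable {d n : ℕ} {Ξ : Type*} [MeasurableSpace Ξ] {F : Fin n → Vec d → Ξ → ℝ}
  {D : Fin n → Measure Ξ} {L : ℝ} {Ω : Type*} [MeasurableSpace Ω] {P : Measure Ω}
  {W : Matrix (Fin n) (Fin n) ℝ} {K : ℕ} {σ τ p ε q : ℝ} {x0 : Vec d}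
  {x c : ℕ → Ω → Fin n → Vec d} {y N : ℕ → ℕ → Ω → Fin n → Vec d}

theorem nodeMean_neg_add_nodeMean (hn : 1 ≤ n) (a : Fin n → Vec d) :
    nodeMean (fun i => -a i + nodeMean a) = 0 := by
  have : (fun i => -a i + nodeMean a) = (fun _ => nodeMean a) - a := by
    ext1 i; simp only [Pi.sub_apply]; abel
  rw [this, nodeMean_sub, nodeMean_const hn, sub_self]

/-- Up to sign, the initial tracking error is the estimation error a − g(v) with its node mean
removed. Exact gradients thus give 0 and single samples at most σ². -/
theorem avgSq_trackErr_init_le (hn : 1 ≤ n) (g : Fin n → Vec d → Vec d) (a : Fin n → Vec d)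
    (v : Vec d) : avgSq (trackErr g (fun i => -a i + nodeMean a) v) ≤
      avgSq fun i => a i - g i v := by
  have e : trackErr g (fun i => -a i + nodeMean a) v =
      -((a - fun i => g i v) - fun _ => nodeMean (a - fun i => g i v)) := by
    rw [nodeMean_sub]
    ext1 i
    simp only [trackErr, Pi.neg_apply, Pi.sub_apply]
    abel
  rw [e, avgSq_neg]
  exact avgSq_sub_mean_le hn _

theorem correctionErr_exact_init (hn : 1 ≤ n) (g : Fin n → Vec d → Vec d)
    (hx : ∀ ω, x 0 ω = fun _ => x0)
    (hc : ∀ ω, c 0 ω = fun i => -g i x0 + nodeMean fun j => g j x0) :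
    correctionErr P g x c 0 = 0 := by
  have h : avgSq (trackErr g (fun i => -g i x0 + nodeMean fun j => g j x0) x0) = 0 :=
    le_antisymm ((avgSq_trackErr_init_le hn g (fun i => g i x0) x0).trans (by simp [avgSq]))
      (avgSq_nonneg _)
  simp only [correctionErr, hx, hc, nodeMean_const hn, h, integral_zero]

variable [IsProbabilityMeasure P]

/-- The accuracy is split into ε/2 for the initial objective gap, ε/4 for the initial tracking
error, and ε/4 for the three noise terms, whose sum is below ε/20. -/
theorem IsTrackingRun.stationaryAfter (hn : 1 ≤ n) (hK : 1 ≤ K) (hL : 0 < L) (hp : 0 < p)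
    (hp1 : p ≤ 1) (hε : 0 < ε) (hq : 0 < q) (hq1 : q ≤ 1 / 1000)
    (h : IsTrackingRun P (fullGrad F D) W K (q * p ^ 2 / (K * L)) σ τ x0 x c y N)
    (hF : IsSmooth F D L) (hW : IsMixing d W p) (hb : BddBelow (Set.range (globalObj F D)))
    (hnoise : q * p ^ 2 * (σ ^ 2 / (K * n)) ≤ ε / 1000)
    (hσ : q ^ 2 * (σ ^ 2 / K) ≤ ε / 1000000) (hτ : q ^ 2 * τ ^ 2 ≤ ε / 1000000) {R : ℝ}
    (hR0 : 4 * (L * (globalObj F D x0 - ⨅ x, globalObj F D x)) / (q * p ^ 2) ≤ ε / 2 * (R + 1))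
    (hR1 : 800 * q ^ 2 * p * correctionErr P (fullGrad F D) x c 0 ≤ ε / 4 * (R + 1)) :
    StationaryAfter P (globalObj F D) x ε R := by
  have hg : ∀ i x y, ‖fullGrad F D i x - fullGrad F D i y‖ ≤ L * ‖x - y‖ := fun i => (hF i).2
  have hgrad : ∀ z, gradient (globalObj F D) z = nodeMean fun j => fullGrad F D j z :=
    fun z => (hasGradientAt_globalObj hF z).gradient
  have hK0 : (0 : ℝ) < K := by exact_mod_cast hK
  refine ⟨fun t => ?_, fun T hT => ?_⟩
  · simp only [hgrad]
    exact h.integrable_meanGrad hK hg t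
  · simp only [hgrad]
    have h1 := h.average_gradSq_le hn hK hL (by positivity) hp hp1 hW hg hq1 (by field_simp)
      (le_quadratic_of_lipschitz_gradient (hasGradientAt_globalObj hF)
        (norm_nodeMean_fullGrad_sub_le hn hL.le hF))
      (continuous_iff_continuousAt.2 fun z => (hasGradientAt_globalObj hF z).continuousAt)
      (fun z => ciInf_le hb z) T
    refine h1.trans ?_
    have h2 : (4 * (L * (globalObj F D x0 - ⨅ x, globalObj F D x)) / (q * p ^ 2)
        + 800 * q ^ 2 * p * correctionErr P (fullGrad F D) x c 0) / ((T : ℝ) + 1) ≤ 3 / 4 * ε := by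
      rw [div_le_iff₀ (by positivity)]
      have : ε * (R + 1) ≤ ε * (T + 1) := by gcongr
      linarith
    linarith

variable {ξ : ℕ → ℕ → Fin n → Ω → Ξ}

theorem memLp_stochGrad_sub (hO : IsStochasticObjective F D) (hF : IsSmooth F D L)
    (hV : HasBoundedVariance F D σ) (hξ : IsSampling P D K ξ) (hK : 1 ≤ K) (x : Vec d)
    (i : Fin n) :
    MemLp (fun ω => stochGrad F i x (ξ 0 0 i ω) - fullGrad F D i x) 2 P ∧
      ∫ ω, ‖stochGrad F i x (ξ 0 0 i ω) - fullGrad F D i x‖ ^ 2 ∂P ≤ σ ^ 2 :=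
  (isOracle_stochGrad hO hV).noise_sq (measurable_fullGrad hF) hO.isProb
    (measurable_const (a := x)) (hξ.measurable 0 0 hK i) (hξ.law 0 0 hK i)
    (indepFun_const_left x _)

theorem memL2_stochGrad (hO : IsStochasticObjective F D) (hF : IsSmooth F D L)
    (hV : HasBoundedVariance F D σ) (hξ : IsSampling P D K ξ) (hK : 1 ≤ K) (x : Vec d) :
    MemL2 P fun ω i => stochGrad F i x (ξ 0 0 i ω) := fun i => by
  have h1 := (memLp_stochGrad_sub hO hF hV hξ hK x i).1.add (memLp_const (fullGrad F D i x))
  refine h1.ae_eq (Filter.Eventually.of_forall fun ω => ?_)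
  simp

theorem correctionErr_stoch_init_le (hn : 1 ≤ n) (hO : IsStochasticObjective F D)
    (hF : IsSmooth F D L) (hV : HasBoundedVariance F D σ) (hξ : IsSampling P D K ξ) (hK : 1 ≤ K)
    (hx : ∀ ω, x 0 ω = fun _ => x0)
    (hc : ∀ ω, c 0 ω = fun i => -stochGrad F i x0 (ξ 0 0 i ω)
      + nodeMean fun j => stochGrad F j x0 (ξ 0 0 j ω)) :
    correctionErr P (fullGrad F D) x c 0 ≤ σ ^ 2 := by
  have hY : MemL2 P fun ω i => stochGrad F i x0 (ξ 0 0 i ω) - fullGrad F D i x0 :=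
    fun i => (memLp_stochGrad_sub hO hF hV hξ hK x0 i).1
  have hn0 : (0 : ℝ) < n := by exact_mod_cast hn
  simp only [correctionErr, hx, hc, nodeMean_const hn]
  calc _ ≤ ∫ ω, avgSq (fun i => stochGrad F i x0 (ξ 0 0 i ω) - fullGrad F D i x0) ∂P :=
        integral_mono_of_nonneg (Filter.Eventually.of_forall fun ω => avgSq_nonneg _)
          hY.integrable_avgSq (Filter.Eventually.of_forall fun ω =>
            avgSq_trackErr_init_le hn (fullGrad F D) (fun i => stochGrad F i x0 (ξ 0 0 i ω)) x0)
    _ ≤ σ ^ 2 := by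
        simp only [avgSq]
        rw [integral_const_mul, integral_finsetSum _ fun i _ => MemLp.integrable_normSq (hY i)]
        calc _ ≤ 1 / (n : ℝ) * ∑ _i : Fin n, σ ^ 2 := by
              gcongr with i; exact (memLp_stochGrad_sub hO hF hV hξ hK x0 i).2
          _ = _ := by simp; field_simp

end Rates

/-! ### Choice of the stepsize -/

/-- The stepsize `K L η`, relative to `p²`; `r` is the factor by which the standard deviation of
the noise in the corrections is reduced. -/
def relStep (n K : ℕ) (σ p ε r : ℝ) : ℝ :=
  1 / (1000 * (1 + σ / (r * √ε) + p ^ 2 * σ ^ 2 / (K * n * ε)))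

section RelStep

variable {n K : ℕ} {σ p ε r : ℝ}

theorem relStep_denom_ge (hσ : 0 ≤ σ) (hε : 0 < ε) (hr : 0 < r) :
    0 ≤ σ / (r * √ε) ∧ 0 ≤ p ^ 2 * σ ^ 2 / (K * n * ε) :=
  ⟨by positivity, by positivity⟩

theorem relStep_pos (hσ : 0 ≤ σ) (hε : 0 < ε) (hr : 0 < r) : 0 < relStep n K σ p ε r := by
  have := relStep_denom_ge (n := n) (K := K) (p := p) hσ hε hr
  have : 0 < 1 + σ / (r * √ε) + p ^ 2 * σ ^ 2 / (K * n * ε) := by linarith [this.1, this.2]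
  unfold relStep; positivity

/-- Applied with `z` a single summand of the denominator: 1 gives smallness, the other two control
one noise term each. -/
theorem relStep_mul_le {z : ℝ} (hσ : 0 ≤ σ) (hε : 0 < ε) (hr : 0 < r)
    (hz : z ≤ 1 + σ / (r * √ε) + p ^ 2 * σ ^ 2 / (K * n * ε)) :
    relStep n K σ p ε r * z ≤ 1 / 1000 := by
  have := relStep_denom_ge (n := n) (K := K) (p := p) hσ hε hr
  have h : 0 < 1 + σ / (r * √ε) + p ^ 2 * σ ^ 2 / (K * n * ε) := by linarith [this.1, this.2]
  unfold relStep
  rw [one_div_mul_eq_div, div_le_div_iff₀ (by positivity) (by norm_num)]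
  linarith

theorem relStep_le (hσ : 0 ≤ σ) (hε : 0 < ε) (hr : 0 < r) :
    relStep n K σ p ε r ≤ 1 / 1000 := by
  have h := relStep_denom_ge (n := n) (K := K) (p := p) hσ hε hr
  simpa using relStep_mul_le (n := n) (K := K) (p := p) (z := 1) hσ hε hr
    (by linarith [h.1, h.2])

theorem relStep_mean_noise_le (hn : 1 ≤ n) (hK : 1 ≤ K) (hσ : 0 ≤ σ) (hε : 0 < ε) (hr : 0 < r) :
    relStep n K σ p ε r * p ^ 2 * (σ ^ 2 / (K * n)) ≤ ε / 1000 := by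
  have h := relStep_denom_ge (n := n) (K := K) (p := p) hσ hε hr
  have hn0 : (0 : ℝ) < n := by exact_mod_cast hn
  have hK0 : (0 : ℝ) < K := by exact_mod_cast hK
  have h1 := relStep_mul_le (n := n) (K := K) (p := p) (z := p ^ 2 * σ ^ 2 / (K * n * ε)) hσ hε hr
    (by linarith [h.1, h.2])
  calc _ = ε * (relStep n K σ p ε r * (p ^ 2 * σ ^ 2 / (K * n * ε))) := by field_simp
    _ ≤ ε * (1 / 1000) := by gcongr
    _ = _ := by ring

theorem relStep_sq_noise_le (hσ : 0 ≤ σ) (hε : 0 < ε) (hr : 0 < r) :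
    relStep n K σ p ε r ^ 2 * (σ ^ 2 / r ^ 2) ≤ ε / 1000000 := by
  have h := relStep_denom_ge (n := n) (K := K) (p := p) hσ hε hr
  have h1 := relStep_mul_le (n := n) (K := K) (p := p) (z := σ / (r * √ε)) hσ hε hr
    (by linarith [h.1, h.2])
  have h0 : 0 ≤ relStep n K σ p ε r * (σ / (r * √ε)) :=
    mul_nonneg (relStep_pos hσ hε hr).le h.1
  have hs : √ε ^ 2 = ε := Real.sq_sqrt hε.le
  calc _ = ε * (relStep n K σ p ε r * (σ / (r * √ε))) ^ 2 := by
        rw [mul_pow, div_pow, mul_pow, hs]; field_simp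
    _ ≤ ε * (1 / 1000) ^ 2 := by gcongr
    _ = _ := by ring

/-- The optimisation term is exactly ε/2 times the claimed number of rounds; the constant 8000 is 2
· 4 · 1000. -/
theorem div_relStep {A : ℝ} (hσ : 0 ≤ σ) (hε : 0 < ε) (hr : 0 < r)
    (hp : 0 < p) : 4 * A / (relStep n K σ p ε r * p ^ 2) =
      ε / 2 * (8000 * (σ ^ 2 / (K * n * ε ^ 2) + σ / (p ^ 2 * r * ε ^ (3 / 2 : ℝ))
        + 1 / (p ^ 2 * ε)) * A) := by
  have h := relStep_denom_ge (n := n) (K := K) (p := p) hσ hε hr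
  have h0 : 0 < 1 + σ / (r * √ε) + p ^ 2 * σ ^ 2 / (K * n * ε) := by linarith [h.1, h.2]
  have h32 : ε ^ (3 / 2 : ℝ) = ε * √ε := by
    rw [show (3 / 2 : ℝ) = 1 + 1 / 2 by norm_num, Real.rpow_add hε, Real.rpow_one,
      Real.sqrt_eq_rpow]
  have e1 : σ ^ 2 / (K * n * ε ^ 2) = 1 / (p ^ 2 * ε) * (p ^ 2 * σ ^ 2 / (K * n * ε)) := by
    field_simp
  have e2 : σ / (p ^ 2 * r * (ε * √ε)) = 1 / (p ^ 2 * ε) * (σ / (r * √ε)) := by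
    field_simp
  rw [h32, e1, e2]
  unfold relStep
  generalize σ / (r * √ε) = a at *
  generalize p ^ 2 * σ ^ 2 / (K * n * ε) = b at *
  field_simp
  ring

end RelStep

/-! ### The two algorithms with their stepsizes -/

section Main

variable {d n : ℕ} {Ξ : Type*} [MeasurableSpace Ξ] {F : Fin n → Vec d → Ξ → ℝ}
  {D : Fin n → Measure Ξ} {L : ℝ} {Ω : Type*} {W : Matrix (Fin n) (Fin n) ℝ} {K : ℕ}
  {σ p ε : ℝ} {x0 : Vec d} {ξ : ℕ → ℕ → Fin n → Ω → Ξ}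

theorem measurable_stochGrad_init {m : MeasurableSpace Ω} (hO : IsStochasticObjective F D)
    (hξ : ∀ i, Measurable[m] (ξ 0 0 i)) (x : Vec d) (i : Fin n) :
    Measurable[m] fun ω => -stochGrad F i x (ξ 0 0 i ω)
      + nodeMean fun j => stochGrad F j x (ξ 0 0 j ω) := by
  have h : ∀ j, Measurable[m] fun ω => stochGrad F j x (ξ 0 0 j ω) := fun j =>
    (hO.measurable_grad j).comp (measurable_const.prodMk (hξ j))
  exact (h i).neg.add (measurable_nodeMean (Y := fun ω j => stochGrad F j x (ξ 0 0 j ω)) h)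

variable [MeasurableSpace Ω] {P : Measure Ω} [IsProbabilityMeasure P]

theorem memL2_stochGrad_init (hO : IsStochasticObjective F D) (hF : IsSmooth F D L)
    (hV : HasBoundedVariance F D σ) (hξ : IsSampling P D K ξ) (hK : 1 ≤ K) (x : Vec d) :
    MemL2 P fun ω i => -stochGrad F i x (ξ 0 0 i ω)
      + nodeMean fun j => stochGrad F j x (ξ 0 0 j ω) := fun i =>
  (memL2_stochGrad hO hF hV hξ hK x i).neg.add (memL2_stochGrad hO hF hV hξ hK x).nodeMean

theorem globalObj_gap_nonneg (hb : BddBelow (Set.range (globalObj F D))) (hL : 0 ≤ L) :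
    0 ≤ L * (globalObj F D x0 - ⨅ x, globalObj F D x) :=
  mul_nonneg hL (sub_nonneg.2 (ciInf_le hb x0))

theorem pgt_stationaryAfter (hn : 1 ≤ n) (hK : 1 ≤ K) (hL : 0 < L) (hσ : 0 ≤ σ) (hp : 0 < p)
    (hp1 : p ≤ 1) (hε : 0 < ε) (hO : IsStochasticObjective F D) (hF : IsSmooth F D L)
    (hV : HasBoundedVariance F D σ) (hW : IsMixing d W p)
    (hb : BddBelow (Set.range (globalObj F D))) (hξ : IsSampling P D K ξ) :
    StationaryAfter P (globalObj F D)
      (fun t ω => (pgt (stochGrad F) W K 1 (relStep n K σ p ε 1 * p ^ 2 / (K * L)) x0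
        (fun t k i => ξ t k i ω) t).1) ε
      (8000 * (σ ^ 2 / (K * n * ε ^ 2) + σ / (p ^ 2 * ε ^ (3 / 2 : ℝ)) + 1 / (p ^ 2 * ε))
        * (L * (globalObj F D x0 - ⨅ x, globalObj F D x))) := by
  have hor := isOracle_stochGrad hO hV
  have hrun := isTrackingRun_track (G := fun _ => stochGrad F) (W := W)
    (η := relStep n K σ p ε 1 * p ^ 2 / (K * L)) (x0 := x0) hK (measurable_fullGrad hF) hO.isProb
    (fun _ _ => hor) hor hξ (fun m hm => measurable_stochGrad_init hO hm x0)
    (memL2_stochGrad_init hO hF hV hξ hK x0) fun ω =>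
      nodeMean_neg_add_nodeMean hn fun i => stochGrad F i x0 (ξ 0 0 i ω)
  have hq := relStep_pos (n := n) (K := K) (p := p) hσ hε one_pos
  have hsq := relStep_sq_noise_le (n := n) (K := K) (p := p) hσ hε one_pos
  have hq1 := relStep_le (n := n) (K := K) (p := p) hσ hε one_pos
  have hmean := relStep_mean_noise_le (p := p) hn hK hσ hε one_pos
  have hdiv := div_relStep (n := n) (K := K)
    (A := L * (globalObj F D x0 - ⨅ x, globalObj F D x)) hσ hε one_pos hp
  rw [one_pow, div_one] at hsq
  rw [mul_one] at hdiv
  have hA := globalObj_gap_nonneg (x0 := x0) hb hL.le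
  set q := relStep n K σ p ε 1
  simp only [pgt_eq _ _ hK]
  set R := 8000 * (σ ^ 2 / (K * n * ε ^ 2) + σ / (p ^ 2 * ε ^ (3 / 2 : ℝ)) + 1 / (p ^ 2 * ε))
    * (L * (globalObj F D x0 - ⨅ x, globalObj F D x))
  have hR : 0 ≤ R := by positivity
  refine hrun.stationaryAfter hn hK hL hp hp1 hε hq hq1 hF hW hb hmean ?_ hsq ?_ ?_
  · refine le_trans ?_ hsq
    gcongr
    exact div_le_self (sq_nonneg σ) (by exact_mod_cast hK)
  · rw [hdiv]; nlinarith
  · refine (mul_le_mul_of_nonneg_left (correctionErr_stoch_init_le hn hO hF hV hξ hK hrun.x_zero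
      fun ω => rfl) (by positivity)).trans ?_
    -- With r = 1 the stepsize already controls q²σ², so the stochastic initialisation costs at most
    -- ε/1250 and is absorbed by the 1 in R + 1.
    calc _ ≤ 800 * q ^ 2 * 1 * σ ^ 2 := by gcongr
      _ ≤ ε / 4 := by linarith
      _ ≤ _ := by nlinarith

theorem fullLast_isOracle (hO : IsStochasticObjective F D) (hF : IsSmooth F D L)
    (hV : HasBoundedVariance F D σ) (K k : ℕ) :
    IsOracle D (fullGrad F D) (fullLast (stochGrad F) (fullGrad F D) K k) σ := by
  unfold fullLast
  split_ifs
  · exact isOracle_stochGrad hO hV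
  · exact (isOracle_exact hO.isProb (measurable_fullGrad hF)).mono (by simpa using sq_nonneg σ)

theorem fullLast_isOracle_last (hO : IsStochasticObjective F D) (hF : IsSmooth F D L) (K : ℕ) :
    IsOracle D (fullGrad F D) (fullLast (stochGrad F) (fullGrad F D) K (K - 1)) 0 := by
  unfold fullLast
  rw [if_neg (by omega)]
  exact isOracle_exact hO.isProb (measurable_fullGrad hF)

theorem fpgt_exact_init_stationaryAfter (hn : 1 ≤ n) (hK : 1 ≤ K) (hL : 0 < L) (hσ : 0 ≤ σ)
    (hp : 0 < p) (hp1 : p ≤ 1) (hε : 0 < ε) (hO : IsStochasticObjective F D) (hF : IsSmooth F D L)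
    (hV : HasBoundedVariance F D σ) (hW : IsMixing d W p)
    (hb : BddBelow (Set.range (globalObj F D))) (hξ : IsSampling P D K ξ) :
    StationaryAfter P (globalObj F D)
      (fun t ω => (fpgt (stochGrad F) (fullGrad F D) W K 1
        (relStep n K σ p ε (√K) * p ^ 2 / (K * L)) x0 (fun i => fullGrad F D i x0)
        (fun t k i => ξ t k i ω) t).1) ε
      (8000 * (σ ^ 2 / (K * n * ε ^ 2) + σ / (p ^ 2 * √K * ε ^ (3 / 2 : ℝ)) + 1 / (p ^ 2 * ε))
        * (L * (globalObj F D x0 - ⨅ x, globalObj F D x))) := by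
  have hr : 0 < √(K : ℝ) := Real.sqrt_pos.2 (by exact_mod_cast hK)
  have hrun := isTrackingRun_track (W := W) (τ := 0)
    (η := relStep n K σ p ε (√K) * p ^ 2 / (K * L)) (x0 := x0)
    (c0 := fun _ i => -fullGrad F D i x0 + nodeMean fun j => fullGrad F D j x0)
    hK (measurable_fullGrad hF) hO.isProb
    (fun k _ => fullLast_isOracle hO hF hV K k) (fullLast_isOracle_last hO hF K) hξ
    (fun m _ i => measurable_const) (fun i => memLp_const _) fun ω =>
      nodeMean_neg_add_nodeMean hn fun i => fullGrad F D i x0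
  have hsq := relStep_sq_noise_le (n := n) (K := K) (p := p) hσ hε hr
  have hdiv := div_relStep (n := n) (K := K)
    (A := L * (globalObj F D x0 - ⨅ x, globalObj F D x)) hσ hε hr hp
  rw [Real.sq_sqrt (by positivity)] at hsq
  have hA := globalObj_gap_nonneg (x0 := x0) hb hL.le
  simp only [fpgt_eq _ _ _ hK]
  refine hrun.stationaryAfter hn hK hL hp hp1 hε (relStep_pos hσ hε hr) (relStep_le hσ hε hr)
    hF hW hb (relStep_mean_noise_le hn hK hσ hε hr) hsq (by simp; positivity) ?_ ?_
  · rw [hdiv]; nlinarith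
  · rw [correctionErr_exact_init hn (fullGrad F D) hrun.x_zero fun ω => rfl, mul_zero]
    positivity

theorem fpgt_stoch_init_stationaryAfter (hn : 1 ≤ n) (hK : 1 ≤ K) (hL : 0 < L) (hσ : 0 ≤ σ)
    (hp : 0 < p) (hp1 : p ≤ 1) (hε : 0 < ε) (hO : IsStochasticObjective F D) (hF : IsSmooth F D L)
    (hV : HasBoundedVariance F D σ) (hW : IsMixing d W p)
    (hb : BddBelow (Set.range (globalObj F D))) (hξ : IsSampling P D K ξ) :
    StationaryAfter P (globalObj F D)
      (fun t ω => (fpgt (stochGrad F) (fullGrad F D) W K 1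
        (relStep n K σ p ε (√K) * p ^ 2 / (K * L)) x0 (fun i => stochGrad F i x0 (ξ 0 0 i ω))
        (fun t k i => ξ t k i ω) t).1) ε
      (8000 * (σ ^ 2 / (K * n * ε ^ 2) + σ / (p ^ 2 * √K * ε ^ (3 / 2 : ℝ)) + 1 / (p ^ 2 * ε))
        * (L * (globalObj F D x0 - ⨅ x, globalObj F D x)) + 8000 * (σ ^ 2 / ε)) := by
  have hr : 0 < √(K : ℝ) := Real.sqrt_pos.2 (by exact_mod_cast hK)
  have hrun := isTrackingRun_track (W := W) (τ := 0)
    (η := relStep n K σ p ε (√K) * p ^ 2 / (K * L)) (x0 := x0)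
    hK (measurable_fullGrad hF) hO.isProb
    (fun k _ => fullLast_isOracle hO hF hV K k) (fullLast_isOracle_last hO hF K) hξ
    (fun m hm => measurable_stochGrad_init hO hm x0)
    (memL2_stochGrad_init hO hF hV hξ hK x0) fun ω =>
      nodeMean_neg_add_nodeMean hn fun i => stochGrad F i x0 (ξ 0 0 i ω)
  have hq := relStep_pos (n := n) (K := K) (p := p) hσ hε hr
  have hq1 := relStep_le (n := n) (K := K) (p := p) hσ hε hr
  have hmean := relStep_mean_noise_le (p := p) hn hK hσ hε hr
  have hsq := relStep_sq_noise_le (n := n) (K := K) (p := p) hσ hε hr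
  have hdiv := div_relStep (n := n) (K := K)
    (A := L * (globalObj F D x0 - ⨅ x, globalObj F D x)) hσ hε hr hp
  rw [Real.sq_sqrt (by positivity)] at hsq
  have hA := globalObj_gap_nonneg (x0 := x0) hb hL.le
  set q := relStep n K σ p ε (√K)
  simp only [fpgt_eq _ _ _ hK]
  set R := 8000 * (σ ^ 2 / (K * n * ε ^ 2) + σ / (p ^ 2 * √K * ε ^ (3 / 2 : ℝ)) + 1 / (p ^ 2 * ε))
    * (L * (globalObj F D x0 - ⨅ x, globalObj F D x))
  have hR : 0 ≤ R := by positivity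
  have hS : ε * (8000 * (σ ^ 2 / ε)) = 8000 * σ ^ 2 := by field_simp
  refine hrun.stationaryAfter hn hK hL hp hp1 hε hq hq1 hF hW hb hmean hsq
    (by simp; positivity) ?_ ?_
  · rw [hdiv]; nlinarith [sq_nonneg σ]
  · have hq2 : q ^ 2 ≤ 1 := pow_le_one₀ hq.le (by linarith)
    have hεR : 0 ≤ ε * R := mul_nonneg hε.le hR
    refine (mul_le_mul_of_nonneg_left (correctionErr_stoch_init_le hn hO hF hV hξ hK hrun.x_zero
      fun ω => rfl) (by positivity)).trans ?_
    -- With r = √K only q²σ²/K is small compared with ε. The initial error is therefore bounded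
    -- using q ≤ 1 and paid for by the additional 8000σ²/ε rounds.
    calc _ ≤ 800 * 1 * 1 * σ ^ 2 := by gcongr
      _ ≤ _ := by nlinarith [sq_nonneg σ]

end Main

end

theorem theorem2 :
    ∃ C : ℝ, 0 < C ∧
      ∀ (n K : ℕ) (L σ p ε : ℝ), 1 ≤ n → 1 ≤ K → 0 < L → 0 ≤ σ → 0 < p → p ≤ 1 → 0 < ε →
        -- Periodical GT
        (∃ ηs ηc : ℝ, 0 < ηs ∧ 0 < ηc ∧ ηs * ηc ≤ C * (p ^ 2 / (K * L)) ∧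
          ∀ (d : ℕ) (Ξ : Type*) [MeasurableSpace Ξ] (F : Fin n → Vec d → Ξ → ℝ)
            (D : Fin n → Measure Ξ) (W : Matrix (Fin n) (Fin n) ℝ) (x0 : Vec d),
            IsStochasticObjective F D → IsSmooth F D L → HasBoundedVariance F D σ →
            IsMixing d W p → BddBelow (Set.range (globalObj F D)) →
            ∀ (Ω : Type*) [MeasurableSpace Ω] (P : Measure Ω) [IsProbabilityMeasure P]
              (ξ : ℕ → ℕ → Fin n → Ω → Ξ), IsSampling P D K ξ →
              StationaryAfter P (globalObj F D)
                (fun t ω => (pgt (stochGrad F) W K ηs ηc x0 (fun t k i => ξ t k i ω) t).1) ε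
                (C * (σ ^ 2 / (K * n * ε ^ 2) + σ / (p ^ 2 * ε ^ (3 / 2 : ℝ)) + 1 / (p ^ 2 * ε))
                  * (L * (globalObj F D x0 - ⨅ x, globalObj F D x)))) ∧
        -- Periodical GT with full-batch tracking
        (∃ ηs ηc : ℝ, 0 < ηs ∧ 0 < ηc ∧ ηs * ηc ≤ C * (p ^ 2 / (K * L)) ∧
          ∀ (d : ℕ) (Ξ : Type*) [MeasurableSpace Ξ] (F : Fin n → Vec d → Ξ → ℝ)
            (D : Fin n → Measure Ξ) (W : Matrix (Fin n) (Fin n) ℝ) (x0 : Vec d),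
            IsStochasticObjective F D → IsSmooth F D L → HasBoundedVariance F D σ →
            IsMixing d W p → BddBelow (Set.range (globalObj F D)) →
            ∀ (Ω : Type*) [MeasurableSpace Ω] (P : Measure Ω) [IsProbabilityMeasure P]
              (ξ : ℕ → ℕ → Fin n → Ω → Ξ), IsSampling P D K ξ →
              -- corrections initialized with the full gradients at the starting point
              StationaryAfter P (globalObj F D)
                (fun t ω => (fpgt (stochGrad F) (fullGrad F D) W K ηs ηc x0
                  (fun i => fullGrad F D i x0) (fun t k i => ξ t k i ω) t).1) ε
                (C * (σ ^ 2 / (K * n * ε ^ 2) + σ / (p ^ 2 * √K * ε ^ (3 / 2 : ℝ))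
                    + 1 / (p ^ 2 * ε))
                  * (L * (globalObj F D x0 - ⨅ x, globalObj F D x))) ∧
              -- corrections initialized with one stochastic gradient per node
              StationaryAfter P (globalObj F D)
                (fun t ω => (fpgt (stochGrad F) (fullGrad F D) W K ηs ηc x0
                  (fun i => stochGrad F i x0 (ξ 0 0 i ω)) (fun t k i => ξ t k i ω) t).1) ε
                (C * (σ ^ 2 / (K * n * ε ^ 2) + σ / (p ^ 2 * √K * ε ^ (3 / 2 : ℝ))
                    + 1 / (p ^ 2 * ε))
                  * (L * (globalObj F D x0 - ⨅ x, globalObj F D x)) + C * (σ ^ 2 / ε))) := by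
  refine ⟨8000, by norm_num, fun n K L σ p ε hn hK hL hσ hp hp1 hε => ?_⟩
  have hK0 : (0 : ℝ) < K := by exact_mod_cast hK
  have hstep : ∀ r : ℝ, 0 < r → 0 < relStep n K σ p ε r * p ^ 2 / (K * L) ∧
      1 * (relStep n K σ p ε r * p ^ 2 / (K * L)) ≤ 8000 * (p ^ 2 / (K * L)) := fun r hr => by
    have hq := relStep_pos (n := n) (K := K) (p := p) hσ hε hr
    have hq1 := relStep_le (n := n) (K := K) (p := p) hσ hε hr
    refine ⟨by positivity, ?_⟩
    rw [one_mul, mul_div_assoc]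
    gcongr
    linarith
  have hr : 0 < √(K : ℝ) := Real.sqrt_pos.2 hK0
  -- The server stepsize is 1, so a round ends in the mixed last local models; r is 1 for Periodical
  -- GT and √K for both initialisations of full-batch tracking.
  refine ⟨⟨1, _, one_pos, (hstep 1 one_pos).1, (hstep 1 one_pos).2, ?_⟩,
    ⟨1, _, one_pos, (hstep _ hr).1, (hstep _ hr).2, ?_⟩⟩
  · intro d Ξ _ F D W x0 hO hF hV hW hb Ω _ P _ ξ hξ
    exact pgt_stationaryAfter hn hK hL hσ hp hp1 hε hO hF hV hW hb hξ
  · intro d Ξ _ F D W x0 hO hF hV hW hb Ω _ P _ ξ hξ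
    exact ⟨fpgt_exact_init_stationaryAfter hn hK hL hσ hp hp1 hε hO hF hV hW hb hξ,
      fpgt_stoch_init_stationaryAfter hn hK hL hσ hp hp1 hε hO hF hV hW hb hξ⟩
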